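/- Let $\Sigma\subset\mathbb C$ be a compact set with connected complement, let $\mu$ be a Borel probability measure supported on $\Sigma$, with logarithmic potential $P(\mu;z)=\int -\log|z-\zeta|\,d\mu(\zeta)\in(-\infty,+\infty]$, and let $f$ be holomorphic on an open set $V\supset\Sigma$. Put $$r_0=\inf_{z\in\Sigma}e^{-P(\mu;z)},\qquad \rho_\mu(K)=\sup_{z\in K}e^{-P(\mu;z)},\qquad E_\mu(r)=\{z\in\mathbb C: e^{-P(\mu;z)}<r\}\quad(r_0<r\le\infty),$$ with $E_\mu(\infty)=\mathbb C$. A meromorphic continuation of $f$ to $E_\mu(r)$ is a meromorphic function $F$ on $E_\mu(r)$ such that for every $s<r$ there is a neighbourhood $W$ of $\Sigma$ with $F=f$ on $W\cap E_\mu(s)$. Poles are counted with multiplicity. For an integer $m\ge 0$ let $R_{\mu,m}\in(r_0,\infty]$ be the supremum of the $r>r_0$ such that $f$ has a meromorphic continuation with at most $m$ poles to $E_\mu(r)$, and let $D_{\mu,m}=E_\mu(R_{\mu,m})$. Let $\alpha_{n,i}\in\Sigma$ ($1\le i\le n$, $n\in\mathbb N$) be a table of points, and let $w_n(z)=\prod_{i=1}^n(z-\alpha_{n,i})$.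 Assume that the table is newtonian, i.e. $w_n$ divides $w_{n+1}$ for all $n\ge1$, and that it has the asymptotic zero distribution $\mu$, i.e. $\frac1n\sum_{i=1}^n\delta_{\alpha_{n,i}}\to\mu$ in the weak* sense. For $n\ge m$ let $\Pi_{n,m}=P/Q$ be the multipoint Padé approximant of $f$: $P,Q$ are polynomials with $\deg P\le n-m$, $\deg Q\le m$, $Q\not\equiv0$, and $(Qf-P)/w_{n+1}$ is holomorphic on $V$. (The rational function $\Pi_{n,m}$ is evaluated after cancelling common factors.) Assume that $f$ is single-valued in the following sense: whenever $r_0<r<\infty$ and $G$ is meromorphic on $E_\mu(r)$ with at most $m$ poles and coincides with $f$ near every limit point of the table lying in $E_\mu(r)$, then $G$ is a meromorphic continuation of $f$ to $E_\mu(r)$. Here a limit point of the table is a point each of whose neighbourhoods contains arbitrarily many of the points $\alpha_{n,1},\dots,\alpha_{n,n}$ (counted with repetition) as $n$ varies. (This is automatic, for example, if every point of $\Sigma$ is a limit point of the table, or if $f$ is the restriction to $V$ of a function meromorphic in $\mathbb C$.) Suppose that $f$ has exactly $m$ poles $z_1,\dots,z_m$ in $D_{\mu,m}$, i.e. that it has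 a meromorphic continuation to $D_{\mu,m}$, again denoted by $f$, with exactly these poles. Then $$\limsup_{n\to\infty}|f(z)-\Pi_{n,m}(z)|^{1/n}=\frac{\rho_\mu(\{z\})}{R_{\mu,m}}<1\qquad\text{for every } z\in D_{\mu,m}\setminus(\Sigma\cup\{z_1,\dots,z_m\}),$$ where the quotient is $0$ if $R_{\mu,m}=\infty$. -/

import Mathlib

open Filter Topology MeasureTheory Polynomial
open scoped ENNReal BoundedContinuousFunction

namespace MultipointPade

noncomputable section

/-! Potential theory -/

/-- The logarithmic potential `P(μ; z) = ∫ -log |z - ζ| dμ(ζ)`, computed as the integral of the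
positive part of `-log |z - ζ|` minus the integral of its negative part. The second integral is
finite for a finite measure with compact support; the first one, hence the potential, may be `+∞`
(here `log 0 = -∞`). -/
def potential (μ : Measure ℂ) (z : ℂ) : EReal :=
  ((∫⁻ ζ, (-ENNReal.log ‖z - ζ‖ₑ).toENNReal ∂μ : ℝ≥0∞) : EReal) -
    ((∫⁻ ζ, (ENNReal.log ‖z - ζ‖ₑ).toENNReal ∂μ : ℝ≥0∞) : EReal)

/-- The function `exp (-P(μ; z))`, with value `0` where the potential is `+∞`. -/
def expNegPotential (μ : Measure ℂ) (z : ℂ) : ℝ≥0∞ :=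
  EReal.exp (-potential μ z)

/-- `r₀ = inf_{z ∈ S} exp (-P(μ; z))`. -/
def rZero (S : Set ℂ) (μ : Measure ℂ) : ℝ≥0∞ :=
  ⨅ z ∈ S, expNegPotential μ z

/-- `E_μ(r) = {z : exp (-P(μ; z)) < r}`; for a measure of compact support `E_μ(∞) = ℂ`. -/
def sublevel (μ : Measure ℂ) (r : ℝ≥0∞) : Set ℂ :=
  {z | expNegPotential μ z < r}

/-- `ρ_μ(K) = sup_{z ∈ K} exp (-P(μ; z))`. -/
def rho (μ : Measure ℂ) (K : Set ℂ) : ℝ≥0∞ :=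
  ⨆ z ∈ K, expNegPotential μ z

/-! Poles and meromorphic continuation -/

/-- The multiplicity of `z` as a pole of `F` (it is `0` if `z` is not a pole). -/
def poleMultiplicity (F : ℂ → ℂ) (z : ℂ) : ℕ :=
  (-(meromorphicOrderAt F z).untop₀).toNat

/-- `F` has finitely many poles in `U`. -/
def HasFinitelyManyPoles (F : ℂ → ℂ) (U : Set ℂ) : Prop :=
  {z ∈ U | poleMultiplicity F z ≠ 0}.Finite

/-- The number of poles of `F` in `U`, counted with multiplicity (meaningful if finite). -/
def poleCount (F : ℂ → ℂ) (U : Set ℂ) : ℕ :=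
  ∑ᶠ z ∈ U, poleMultiplicity F z

/-- `F` has at most `m` poles in `U`, counting multiplicities. -/
def HasAtMostPoles (F : ℂ → ℂ) (U : Set ℂ) (m : ℕ) : Prop :=
  HasFinitelyManyPoles F U ∧ poleCount F U ≤ m

/-- `F` has exactly `m` poles in `U`, counting multiplicities. -/
def HasExactlyPoles (F : ℂ → ℂ) (U : Set ℂ) (m : ℕ) : Prop :=
  HasFinitelyManyPoles F U ∧ poleCount F U = m

/-- `F` is a meromorphic continuation to `E_μ(r)` of the function `f`, given near `S`: it is
meromorphic there (normal form means that it is holomorphic away from its poles and takes the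
dummy value `0` at the poles), and for every `s < r` it coincides with `f` on the part of `E_μ(s)`
in some neighbourhood of `S`. So only the germ of `f` along `S` matters; since the neighbourhood may
shrink as `s` increases to `r`, nothing is required at points of `S` on the boundary of `E_μ(r)`
that are at a positive distance from every `E_μ(s)`, `s < r`. -/
def IsMeromorphicContinuation (S : Set ℂ) (μ : Measure ℂ) (f : ℂ → ℂ) (r : ℝ≥0∞)
    (F : ℂ → ℂ) : Prop :=
  MeromorphicNFOn F (sublevel μ r) ∧
    ∀ s < r, ∃ W : Set ℂ, IsOpen W ∧ S ⊆ W ∧ Set.EqOn F f (W ∩ sublevel μ s)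

/-- `R_{μ,m}`: the supremum (possibly `∞`) of the finite `r > r₀` such that `f` admits a
meromorphic continuation with at most `m` poles to `E_μ(r)`. -/
def radius (S : Set ℂ) (μ : Measure ℂ) (f : ℂ → ℂ) (m : ℕ) : ℝ≥0∞ :=
  sSup {r : ℝ≥0∞ | r < ⊤ ∧ rZero S μ < r ∧
    ∃ F : ℂ → ℂ, IsMeromorphicContinuation S μ f r F ∧ HasAtMostPoles F (sublevel μ r) m}

/-- `D_{μ,m} = E_μ(R_{μ,m})`, the set of `m`-meromorphy of `f` relative to `μ`. -/
def meromorphySet (S : Set ℂ) (μ : Measure ℂ) (f : ℂ → ℂ) (m : ℕ) : Set ℂ :=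
  sublevel μ (radius S μ f m)

/-! Tables of interpolation points -/

/-- `w_n(z) = ∏_{i=1}^n (z - α_{n,i})`. -/
def nodePoly (α : (n : ℕ) → Fin n → ℂ) (n : ℕ) : ℂ[X] :=
  ∏ i : Fin n, (X - C (α n i))

/-- The table is newtonian: `w_n` divides `w_{n+1}` for all `n ≥ 1`. -/
def IsNewtonian (α : (n : ℕ) → Fin n → ℂ) : Prop :=
  ∀ n : ℕ, 1 ≤ n → nodePoly α n ∣ nodePoly α (n + 1)

/-- The normalized zero counting measure of `w_n`. -/
def zeroCounting (α : (n : ℕ) → Fin n → ℂ) (n : ℕ) : Measure ℂ :=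
  (n : ℝ≥0∞)⁻¹ • ∑ i : Fin n, Measure.dirac (α n i)

/-- The table has the asymptotic zero distribution `μ`: the zero counting measures converge to `μ`
in the weak-star sense. (All measures involved will live on one compact subset of `ℂ`, so bounded
continuous functions on the plane and continuous functions on the sphere test the same.) -/
def HasZeroDistribution (α : (n : ℕ) → Fin n → ℂ) (μ : Measure ℂ) : Prop :=
  ∀ φ : ℂ →ᵇ ℝ, Tendsto (fun n => ∫ z, φ z ∂(zeroCounting α n)) atTop (𝓝 (∫ z, φ z ∂μ))

/-- `z` is a limit point of the table: every neighbourhood of `z` contains arbitrarily many of the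
points `α_{n,1}, …, α_{n,n}`, counted with repetition, as `n` varies. -/
def IsLimitNode (α : (n : ℕ) → Fin n → ℂ) (z : ℂ) : Prop :=
  ∀ U ∈ 𝓝 z, ∀ k : ℕ, ∃ n : ℕ, k ≤ {i : Fin n | α n i ∈ U}.ncard

/-- `f` is single-valued for the table: a function that is meromorphic with at most `m` poles on
some `E_μ(r)`, `r > r₀`, and coincides with `f` near all limit points of the table in `E_μ(r)`, is
a meromorphic continuation of `f`. This is automatic, for instance, if every point of `S` is a
limit point of the table, or if `f` is the restriction of a function meromorphic in the plane. -/
def IsSingleValued (S : Set ℂ) (μ : Measure ℂ) (α : (n : ℕ) → Fin n → ℂ) (f : ℂ → ℂ)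
    (m : ℕ) : Prop :=
  ∀ r : ℝ≥0∞, r < ⊤ → rZero S μ < r → ∀ G : ℂ → ℂ,
    MeromorphicNFOn G (sublevel μ r) → HasAtMostPoles G (sublevel μ r) m →
    (∀ z ∈ sublevel μ r, IsLimitNode α z → G =ᶠ[𝓝 z] f) →
    IsMeromorphicContinuation S μ f r G

/-! Multipoint Padé approximants -/

/-- The rational function `R` is the multipoint Padé approximant `Π_{n,m}` (for `n ≥ m`) of the
function `f`, holomorphic in the open set `V`: `R = P / Q` with `deg P ≤ n - m`, `deg Q ≤ m`,
`Q ≢ 0`, and `(Q f - P) / w_{n+1}` holomorphic in `V`. -/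
def IsMultipointPade (V : Set ℂ) (f : ℂ → ℂ) (α : (n : ℕ) → Fin n → ℂ) (n m : ℕ)
    (R : RatFunc ℂ) : Prop :=
  ∃ P Q : ℂ[X], P.natDegree ≤ n - m ∧ Q.natDegree ≤ m ∧ Q ≠ 0 ∧
    (∃ g : ℂ → ℂ, DifferentiableOn ℂ g V ∧
      ∀ z ∈ V, Q.eval z * f z - P.eval z = (nodePoly α (n + 1)).eval z * g z) ∧
    R = algebraMap ℂ[X] (RatFunc ℂ) P / algebraMap ℂ[X] (RatFunc ℂ) Q

/-- The value of a rational function at a point, after cancellation of common factors (`0` at a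
pole). -/
def ratEval (R : RatFunc ℂ) (z : ℂ) : ℂ :=
  R.eval (RingHom.id ℂ) z

end

end MultipointPade

open MultipointPade

/-! Write `u = exp(-P(μ; ·))`, `R` for the radius and `q` for the monic polynomial of the poles, of
degree `m`. Everything rests on the size of the node polynomials: asymptotically `|w_n|^{1/n}` is at
most `u` locally uniformly in the plane and at least `u` locally uniformly off `S`
(`eventually_norm_nodePoly_le`, `eventually_le_norm_nodePoly`).

Upper bound. For `s < R` both `q f` and `h_n = (Q_n q f - q P_n) / w_{n+1}` are holomorphic near the
compact set `S ∪ {u ≤ s}`. In Cauchy's formula for `h_n` around this set the term `q P_n / w_{n+1}`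
contributes nothing, because `deg (q P_n) ≤ n`; so `h_n = O(s^{-n})` while the `Q_n` stay bounded
(`exists_hermite_bound`). Near a pole `w_{n+1} h_n → 0`, so `q P_n` and `Q_n q f` have the same
limit along a subsequence. The former vanish there to the order of `q`, and `q f` does not vanish;
hence `q` divides every limit of normalized denominators, and by degree such a limit is a multiple
of `q` (`tendsto_coeff_div_coeff`). With `Q_n → q`, the identity `f - Π_n = w_{n+1} h_n / (q Q_n)`
gives the bound `u / s`, and `s` tends to `R` (`limsup_le_div`).

Lower bound. For a newtonian table `P_{n+1} Q_n - P_n Q_{n+1}` is divisible by `w_{n+1}` and has no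
larger degree, so it equals `A_n w_{n+1}` with a constant `A_n` (`PadeData.exists_sub_eq`). Too fast
convergence at a single point off `S` makes `A_n` small, and the telescoping series then converges
on some `E_μ(r)` with `r > R`. Its limit `p / q` has at most `m` poles and equals `f` near the limit
points of the table, where the interpolation conditions accumulate. Single-valuedness makes it a
continuation of `f`, against the definition of `R` (`exists_continuation_of_fast`). -/

namespace MultipointPade

noncomputable section

/-! ### Logarithmic potentials and node polynomials -/

/-- The integrand of the truncated logarithmic potential. -/
def truncLog (M : ℕ) (d : ℝ) : ℝ :=
  Real.log (max (Real.exp (-M)) d)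

/-- The truncated logarithmic potential (with the opposite sign). -/
def truncPot (μ : Measure ℂ) (M : ℕ) (z : ℂ) : ℝ :=
  ∫ ζ, truncLog M ‖z - ζ‖ ∂μ

lemma max_exp_pos (M : ℕ) (d : ℝ) : 0 < max (Real.exp (-M)) d :=
  lt_max_of_lt_left (Real.exp_pos _)

lemma truncLog_antitone (d : ℝ) : Antitone fun M => truncLog M d := by
  intro M N h
  refine Real.log_le_log (max_exp_pos _ _) (max_le_max_right _ (Real.exp_le_exp.2 ?_))
  have : (M : ℝ) ≤ N := by exact_mod_cast h
  linarith

lemma truncLog_eq {M : ℕ} {d : ℝ} (h : Real.exp (-M) ≤ d) : truncLog M d = Real.log d := by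
  rw [truncLog, max_eq_right h]

lemma continuous_truncLog (M : ℕ) : Continuous (truncLog M) := by
  unfold truncLog
  exact Continuous.log (by fun_prop) fun d => (max_exp_pos M d).ne'

/-- Follows from `log a - log b ≤ a / b - 1` and `b ≥ exp (-M)`. The Lipschitz constant depends on
`M` alone, so estimates at one point spread to a neighbourhood uniformly in `n`. -/
lemma truncLog_le_add (M : ℕ) (d e : ℝ) :
    truncLog M d ≤ truncLog M e + Real.exp M * |d - e| := by
  have hd := max_exp_pos M d
  have he := max_exp_pos M e
  have h1 : truncLog M d - truncLog M e ≤
      max (Real.exp (-M)) d / max (Real.exp (-M)) e - 1 := by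
    unfold truncLog
    rw [← Real.log_div hd.ne' he.ne']
    exact Real.log_le_sub_one_of_pos (div_pos hd he)
  have h2 : max (Real.exp (-M)) d - max (Real.exp (-M)) e ≤ |d - e| := by
    have := abs_max_sub_max_le_max (Real.exp (-M)) d (Real.exp (-M)) e
    rw [sub_self, abs_zero, max_eq_right (abs_nonneg (d - e))] at this
    exact (le_abs_self _).trans this
  have h3 : max (Real.exp (-M)) d / max (Real.exp (-M)) e - 1 ≤ Real.exp M * |d - e| := by
    rw [div_sub_one he.ne', div_le_iff₀ he]
    refine h2.trans ?_
    have : 1 ≤ Real.exp M * max (Real.exp (-M)) e := by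
      calc (1 : ℝ) = Real.exp M * Real.exp (-M) := by rw [← Real.exp_add]; simp
        _ ≤ _ := by gcongr; exact le_max_left _ _
    nlinarith [abs_nonneg (d - e)]
  linarith

lemma truncLog_norm_le_add (M : ℕ) (z w ζ : ℂ) :
    truncLog M ‖z - ζ‖ ≤ truncLog M ‖w - ζ‖ + Real.exp M * ‖z - w‖ := by
  refine (truncLog_le_add M _ ‖w - ζ‖).trans ?_
  gcongr
  simpa using abs_norm_sub_norm_le (z - ζ) (w - ζ)

/-- Since `exp (-M) ≤ 1`, truncation alters the logarithm only where it is negative. -/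
lemma ofReal_truncLog (M : ℕ) {d : ℝ} (hd : 0 ≤ d) :
    ENNReal.ofReal (truncLog M d) = (ENNReal.log (ENNReal.ofReal d)).toENNReal := by
  have hM : Real.exp (-M) ≤ 1 := Real.exp_le_one_iff.2 (by simp)
  rcases hd.eq_or_lt with rfl | hd0
  · simp [truncLog, max_eq_left (Real.exp_pos _).le]
  rw [ENNReal.log_ofReal_of_pos hd0, EReal.toENNReal_of_ne_top (by simp), EReal.toReal_coe]
  rcases le_total d 1 with h | h
  · rw [ENNReal.ofReal_of_nonpos, ENNReal.ofReal_of_nonpos (Real.log_nonpos hd h)]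
    exact Real.log_nonpos (max_exp_pos _ _).le (max_le hM h)
  · rw [truncLog_eq (hM.trans h)]

lemma iSup_ofReal_neg_truncLog {d : ℝ} (hd : 0 ≤ d) :
    ⨆ M, ENNReal.ofReal (-truncLog M d) = (-ENNReal.log (ENNReal.ofReal d)).toENNReal := by
  rcases hd.eq_or_lt with rfl | hd0
  · simp only [truncLog, max_eq_left (Real.exp_pos _).le, Real.log_exp, neg_neg,
      ENNReal.ofReal_natCast, ENNReal.ofReal_zero, ENNReal.log_zero, EReal.neg_bot,
      EReal.toENNReal_top]
    exact ENNReal.iSup_natCast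
  rw [ENNReal.log_ofReal_of_pos hd0, ← EReal.coe_neg, EReal.toENNReal_of_ne_top (by simp),
    EReal.toReal_coe]
  apply le_antisymm
  · refine iSup_le fun M => ENNReal.ofReal_le_ofReal (neg_le_neg ?_)
    exact Real.log_le_log hd0 (le_max_right _ _)
  · obtain ⟨M, hM⟩ := exists_nat_ge (-Real.log d)
    refine le_iSup_of_le M ?_
    rw [truncLog_eq]
    rw [← Real.le_log_iff_exp_le hd0]
    linarith

/-! ### The potential as a monotone limit of truncated potentials -/

section Potential

variable {S : Set ℂ} {μ : Measure ℂ}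

lemma continuous_truncLog_norm (M : ℕ) (z : ℂ) : Continuous fun ζ => truncLog M ‖z - ζ‖ :=
  (continuous_truncLog M).comp (by fun_prop)

lemma ae_mem_of_compl_null (hμ : μ Sᶜ = 0) : ∀ᵐ ζ ∂μ, ζ ∈ S := mem_ae_iff.2 hμ

lemma integrable_of_continuous (hS : IsCompact S) [IsFiniteMeasure μ] (hμ : μ Sᶜ = 0)
    {ψ : ℂ → ℝ} (hψ : Continuous ψ) : Integrable ψ μ := by
  have := hψ.continuousOn.integrableOn_compact (μ := μ) hS
  rwa [IntegrableOn, Measure.restrict_eq_self_of_ae_mem (ae_mem_of_compl_null hμ)] at this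

lemma integrable_truncLog (hS : IsCompact S) [IsFiniteMeasure μ] (hμ : μ Sᶜ = 0) (M : ℕ) (z : ℂ) :
    Integrable (fun ζ => truncLog M ‖z - ζ‖) μ :=
  integrable_of_continuous hS hμ (continuous_truncLog_norm M z)

/-- The potential as the difference of its parts, the negative one being a supremum of truncations. -/
lemma potential_eq (z : ℂ) :
    potential μ z = ((⨆ M, ∫⁻ ζ, ENNReal.ofReal (-truncLog M ‖z - ζ‖) ∂μ : ℝ≥0∞) : EReal) -
      ((∫⁻ ζ, ENNReal.ofReal (truncLog 0 ‖z - ζ‖) ∂μ : ℝ≥0∞) : EReal) := by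
  rw [potential, ← lintegral_iSup]
  · simp only [iSup_ofReal_neg_truncLog (norm_nonneg _), ofReal_truncLog 0 (norm_nonneg _),
      ofReal_norm]
  · exact fun M => ((continuous_truncLog_norm M z).neg.measurable).ennreal_ofReal
  · intro M N h ζ
    exact ENNReal.ofReal_le_ofReal (neg_le_neg (truncLog_antitone _ h))

lemma lintegral_ofReal_truncLog (M : ℕ) (z : ℂ) :
    ∫⁻ ζ, ENNReal.ofReal (truncLog M ‖z - ζ‖) ∂μ = ∫⁻ ζ, ENNReal.ofReal (truncLog 0 ‖z - ζ‖) ∂μ := by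
  simp only [ofReal_truncLog _ (norm_nonneg _)]

variable [IsProbabilityMeasure μ]

lemma truncPot_antitone (hS : IsCompact S) (hμ : μ Sᶜ = 0) (z : ℂ) :
    Antitone fun M => truncPot μ M z := fun _ _ h =>
  integral_mono (integrable_truncLog hS hμ _ z) (integrable_truncLog hS hμ _ z)
    fun _ => truncLog_antitone _ h

lemma truncPot_le_add (hS : IsCompact S) (hμ : μ Sᶜ = 0) (M : ℕ) (z w : ℂ) :
    truncPot μ M z ≤ truncPot μ M w + Real.exp M * ‖z - w‖ := by
  have h := integral_mono (integrable_truncLog hS hμ M z)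
    ((integrable_truncLog hS hμ M w).add (integrable_const (Real.exp M * ‖z - w‖)))
    fun ζ => truncLog_norm_le_add M z w ζ
  refine h.trans (le_of_eq ?_)
  simp only [Pi.add_apply]
  rw [integral_add (integrable_truncLog hS hμ M w) (integrable_const _)]
  simp [truncPot]

lemma truncPot_eq (hS : IsCompact S) (hμ : μ Sᶜ = 0) (M : ℕ) (z : ℂ) :
    truncPot μ M z = (∫⁻ ζ, ENNReal.ofReal (truncLog 0 ‖z - ζ‖) ∂μ).toReal -
      (∫⁻ ζ, ENNReal.ofReal (-truncLog M ‖z - ζ‖) ∂μ).toReal := by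
  rw [truncPot, integral_eq_lintegral_pos_part_sub_lintegral_neg_part
    (integrable_truncLog hS hμ M z), lintegral_ofReal_truncLog]

lemma lintegral_truncLog_ne_top (hS : IsCompact S) (hμ : μ Sᶜ = 0) (M : ℕ) (z : ℂ) :
    ∫⁻ ζ, ENNReal.ofReal (truncLog M ‖z - ζ‖) ∂μ ≠ ⊤ :=
  ((integrable_truncLog hS hμ M z).lintegral_lt_top).ne

lemma lintegral_neg_truncLog_ne_top (hS : IsCompact S) (hμ : μ Sᶜ = 0) (M : ℕ) (z : ℂ) :
    ∫⁻ ζ, ENNReal.ofReal (-truncLog M ‖z - ζ‖) ∂μ ≠ ⊤ :=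
  ((integrable_truncLog hS hμ M z).neg.lintegral_lt_top).ne

lemma coe_ennreal_eq_coe_toReal {a : ℝ≥0∞} (ha : a ≠ ⊤) : (a : EReal) = (a.toReal : EReal) := by
  lift a to NNReal using ha
  rfl

lemma expNegPotential_le (hS : IsCompact S) (hμ : μ Sᶜ = 0) (M : ℕ) (z : ℂ) :
    expNegPotential μ z ≤ ENNReal.ofReal (Real.exp (truncPot μ M z)) := by
  rw [expNegPotential, ← EReal.exp_coe, EReal.exp_le_exp_iff, potential_eq]
  have hA := lintegral_neg_truncLog_ne_top hS hμ M z
  have hB := lintegral_truncLog_ne_top hS hμ 0 z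
  rw [EReal.neg_le, truncPot_eq hS hμ, ← EReal.coe_neg, neg_sub, EReal.coe_sub,
    ← coe_ennreal_eq_coe_toReal hA, ← coe_ennreal_eq_coe_toReal hB]
  refine EReal.sub_le_sub ?_ le_rfl
  exact EReal.coe_ennreal_le_coe_ennreal_iff.2
    (le_iSup (fun M => ∫⁻ ζ, ENNReal.ofReal (-truncLog M ‖z - ζ‖) ∂μ) M)

/-- Monotone convergence: if all truncated potentials stayed above `log r`, the integrals of their
negative parts would be bounded by `B - log r`, with `B` the common integral of the positive parts.
The same bound would then hold for their supremum. -/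
lemma exists_truncPot_lt (hS : IsCompact S) (hμ : μ Sᶜ = 0) {z : ℂ} {r : ℝ}
    (hr : expNegPotential μ z < ENNReal.ofReal r) : ∃ M, truncPot μ M z < Real.log r := by
  have hr0 : 0 < r := ENNReal.ofReal_pos.1 (bot_le.trans_lt hr)
  by_contra! hcon
  refine hr.not_ge ?_
  rw [expNegPotential, ← Real.exp_log hr0, ← EReal.exp_coe, EReal.exp_le_exp_iff, potential_eq,
    EReal.le_neg]
  have hB := lintegral_truncLog_ne_top hS hμ 0 z
  set B := ∫⁻ ζ, ENNReal.ofReal (truncLog 0 ‖z - ζ‖) ∂μ with hBdef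
  have h1 : ⨆ M, ∫⁻ ζ, ENNReal.ofReal (-truncLog M ‖z - ζ‖) ∂μ ≤
      ENNReal.ofReal (B.toReal - Real.log r) := by
    refine iSup_le fun M => ?_
    have hA := lintegral_neg_truncLog_ne_top hS hμ M z
    rw [← ENNReal.ofReal_toReal hA]
    refine ENNReal.ofReal_le_ofReal ?_
    have := hcon M
    rw [truncPot_eq hS hμ] at this
    linarith
  have h2 : 0 ≤ B.toReal - Real.log r := by
    have := hcon 0
    rw [truncPot_eq hS hμ] at this
    have h3 := ENNReal.toReal_nonneg (a := ∫⁻ ζ, ENNReal.ofReal (-truncLog 0 ‖z - ζ‖) ∂μ)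
    linarith
  refine (EReal.sub_le_sub (EReal.coe_ennreal_le_coe_ennreal_iff.2 h1) le_rfl).trans ?_
  rw [EReal.coe_ennreal_ofReal, max_eq_left h2, coe_ennreal_eq_coe_toReal hB, ← EReal.coe_sub,
    ← EReal.coe_neg, EReal.coe_le_coe_iff]
  linarith

/-- At distance at least `exp (-M)` from `S` the truncation is never active, so increasing `M`
further changes nothing. -/
lemma expNegPotential_eq (hS : IsCompact S) (hμ : μ Sᶜ = 0) {M : ℕ} {z : ℂ}
    (h : ∀ ζ ∈ S, Real.exp (-M) ≤ ‖z - ζ‖) :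
    expNegPotential μ z = ENNReal.ofReal (Real.exp (truncPot μ M z)) := by
  refine (expNegPotential_le hS hμ M z).antisymm (le_of_not_gt fun hlt => ?_)
  obtain ⟨N, hN⟩ := exists_truncPot_lt hS hμ hlt
  rw [Real.log_exp] at hN
  have h1 : truncPot μ (max M N) z ≤ truncPot μ N z := truncPot_antitone hS hμ z (le_max_right _ _)
  have h2 : truncPot μ (max M N) z = truncPot μ M z := by
    refine integral_congr_ae ?_
    filter_upwards [ae_mem_of_compl_null hμ] with ζ hζ
    rw [truncLog_eq (h ζ hζ), truncLog_eq]
    refine le_trans (Real.exp_le_exp.2 ?_) (h ζ hζ)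
    have : (M : ℝ) ≤ (max M N : ℕ) := by exact_mod_cast le_max_left _ _
    linarith
  linarith

lemma expNegPotential_lt_top (hS : IsCompact S) (hμ : μ Sᶜ = 0) (z : ℂ) :
    expNegPotential μ z < ⊤ :=
  (expNegPotential_le hS hμ 0 z).trans_lt ENNReal.ofReal_lt_top

lemma nonempty_of_compl_null (hμ : μ Sᶜ = 0) : S.Nonempty := by
  rw [Set.nonempty_iff_ne_empty]
  rintro rfl
  simp at hμ

lemma exists_exp_neg_le {δ : ℝ} (hδ : 0 < δ) : ∃ M : ℕ, Real.exp (-M) ≤ δ := by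
  obtain ⟨M, hM⟩ := exists_nat_ge (-Real.log δ)
  exact ⟨M, by rw [← Real.le_log_iff_exp_le hδ]; linarith⟩

lemma infDist_pos_of_notMem (hS : IsCompact S) (hμ : μ Sᶜ = 0) {z : ℂ} (hz : z ∉ S) :
    0 < Metric.infDist z S :=
  (hS.isClosed.notMem_iff_infDist_pos (nonempty_of_compl_null hμ)).1 hz

lemma infDist_le_norm_sub {z ζ : ℂ} (hζ : ζ ∈ S) : Metric.infDist z S ≤ ‖z - ζ‖ := by
  rw [← dist_eq_norm]
  exact Metric.infDist_le_dist_of_mem hζ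

/-- The logarithm of the distance to `S` bounds the integrand from below, and `μ` has mass one. This
growth at infinity makes the sublevel sets bounded. -/
lemma ofReal_infDist_le (hS : IsCompact S) (hμ : μ Sᶜ = 0) (z : ℂ) :
    ENNReal.ofReal (Metric.infDist z S) ≤ expNegPotential μ z := by
  by_cases hz : z ∈ S
  · simp [Metric.infDist_zero_of_mem hz]
  have hpos := infDist_pos_of_notMem hS hμ hz
  obtain ⟨M, hM⟩ := exists_exp_neg_le hpos
  rw [expNegPotential_eq hS hμ (M := M) fun ζ hζ => hM.trans (infDist_le_norm_sub hζ)]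
  refine ENNReal.ofReal_le_ofReal ?_
  rw [← Real.log_le_iff_le_exp hpos]
  have : ∫ ζ, Real.log (Metric.infDist z S) ∂μ ≤ truncPot μ M z := by
    refine integral_mono_ae (integrable_const _) (integrable_truncLog hS hμ M z) ?_
    filter_upwards [ae_mem_of_compl_null hμ] with ζ hζ
    rw [truncLog_eq (hM.trans (infDist_le_norm_sub hζ))]
    exact Real.log_le_log hpos (infDist_le_norm_sub hζ)
  simpa using this

lemma isBounded_setOf_expNegPotential_le (hS : IsCompact S) (hμ : μ Sᶜ = 0) (r : ℝ) :
    Bornology.IsBounded {z | expNegPotential μ z ≤ ENNReal.ofReal r} := by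
  refine (hS.isBounded.cthickening (δ := r)).subset fun z hz => ?_
  have h1 := (ofReal_infDist_le hS hμ z).trans hz
  rwa [Metric.infDist, ENNReal.ofReal_toReal
    (Metric.infEDist_ne_top (nonempty_of_compl_null hμ)), ← Metric.mem_cthickening_iff] at h1

end Potential

/-! ### Asymptotics of the node polynomials -/

section Nodes

variable {S : Set ℂ} {μ : Measure ℂ} {α : (n : ℕ) → Fin n → ℂ}

lemma eval_nodePoly (n : ℕ) (z : ℂ) : (nodePoly α n).eval z = ∏ i, (z - α n i) := by
  simp [nodePoly, eval_prod]

lemma eval_nodePoly_ne_zero (hα : ∀ n i, α n i ∈ S) (n : ℕ) {z : ℂ} (hz : z ∉ S) :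
    (nodePoly α n).eval z ≠ 0 := by
  rw [eval_nodePoly, Finset.prod_ne_zero_iff]
  intro i _ h
  exact hz (sub_eq_zero.1 h ▸ hα n i)

lemma integral_zeroCounting (n : ℕ) (φ : ℂ → ℝ) :
    ∫ z, φ z ∂(zeroCounting α n) = (n : ℝ)⁻¹ * ∑ i, φ (α n i) := by
  rw [zeroCounting, integral_smul_measure, integral_finsetSum_measure]
  · simp
  · exact fun i _ => integrable_dirac (by simp)

/-- Weak-star convergence may be tested on continuous functions, as the nodes are bounded. -/
lemma tendsto_average (hS : IsCompact S) (hμ : μ Sᶜ = 0) (hα : ∀ n i, α n i ∈ S)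
    (hdist : HasZeroDistribution α μ) {ψ : ℂ → ℝ} (hψ : Continuous ψ) :
    Tendsto (fun n : ℕ => (n : ℝ)⁻¹ * ∑ i, ψ (α n i)) atTop (𝓝 (∫ ζ, ψ ζ ∂μ)) := by
  obtain ⟨b, hb⟩ := hS.exists_bound_of_continuousOn hψ.continuousOn
  -- `ψ` clipped to `[-b, b]`, where `b` bounds `|ψ|` on `S`; neither the nodes nor `μ` see the
  -- clipping.
  let φ : ℂ →ᵇ ℝ := BoundedContinuousFunction.ofNormedAddCommGroup
    (fun ζ => max (-b) (min b (ψ ζ))) (by fun_prop) |b| (fun ζ => by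
      rw [Real.norm_eq_abs, abs_le]
      constructor
      · exact (neg_le_neg (le_abs_self b)).trans (le_max_left _ _)
      · exact max_le (neg_le_abs b) ((min_le_left _ _).trans (le_abs_self b)))
  have hφ : ∀ ζ ∈ S, φ ζ = ψ ζ := fun ζ hζ => by
    have := abs_le.1 (hb ζ hζ)
    change max (-b) (min b (ψ ζ)) = ψ ζ
    rw [min_eq_right this.2, max_eq_right this.1]
  have h := hdist φ
  have e1 : ∫ ζ, φ ζ ∂μ = ∫ ζ, ψ ζ ∂μ :=
    integral_congr_ae ((ae_mem_of_compl_null hμ).mono hφ)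
  rw [e1] at h
  refine h.congr fun n => ?_
  rw [integral_zeroCounting n φ]
  simp only [hφ _ (hα n _)]

lemma norm_eval_nodePoly_le (M n : ℕ) (z : ℂ) :
    ‖(nodePoly α n).eval z‖ ≤ Real.exp (∑ i, truncLog M ‖z - α n i‖) := by
  rw [eval_nodePoly, norm_prod, Real.exp_sum]
  refine Finset.prod_le_prod (fun _ _ => norm_nonneg _) fun i _ => ?_
  rw [truncLog, Real.exp_log (max_exp_pos _ _)]
  exact le_max_right _ _

lemma norm_eval_nodePoly_eq {M n : ℕ} {z : ℂ} (h : ∀ i, Real.exp (-M) ≤ ‖z - α n i‖) :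
    ‖(nodePoly α n).eval z‖ = Real.exp (∑ i, truncLog M ‖z - α n i‖) := by
  rw [eval_nodePoly, norm_prod, Real.exp_sum]
  refine Finset.prod_congr rfl fun i _ => ?_
  rw [truncLog_eq (h i), Real.exp_log ((Real.exp_pos _).trans_le (h i))]

lemma sum_truncLog_le (M n : ℕ) (z w : ℂ) :
    ∑ i, truncLog M ‖z - α n i‖ ≤
      ∑ i, truncLog M ‖w - α n i‖ + n * (Real.exp M * ‖z - w‖) := by
  calc ∑ i, truncLog M ‖z - α n i‖
      ≤ ∑ i, (truncLog M ‖w - α n i‖ + Real.exp M * ‖z - w‖) :=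
        Finset.sum_le_sum fun i _ => truncLog_norm_le_add M z w _
    _ = _ := by simp [Finset.sum_add_distrib]

lemma eventually_exp_mul_norm_sub_lt (M : ℕ) (z₀ : ℂ) {δ : ℝ} (hδ : 0 < δ) :
    ∀ᶠ z in 𝓝 z₀, Real.exp M * ‖z - z₀‖ < δ := by
  have : Tendsto (fun z => Real.exp M * ‖z - z₀‖) (𝓝 z₀) (𝓝 (Real.exp M * ‖z₀ - z₀‖)) :=
    Continuous.tendsto (by fun_prop) z₀
  refine this.eventually_lt_const ?_
  simpa using hδ

lemma exp_nat_mul_log {r : ℝ} (hr : 0 < r) (n : ℕ) : Real.exp (n * Real.log r) = r ^ n := by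
  rw [mul_comm, Real.exp_mul, Real.exp_log hr, Real.rpow_natCast]

variable [IsProbabilityMeasure μ]

/-- Upper semicontinuity: `u` is the infimum of the continuous functions `exp (truncPot μ M ·)`. -/
lemma eventually_expNegPotential_lt (hS : IsCompact S) (hμ : μ Sᶜ = 0) {z₀ : ℂ} {r : ℝ}
    (hr : expNegPotential μ z₀ < ENNReal.ofReal r) :
    ∀ᶠ z in 𝓝 z₀, expNegPotential μ z < ENNReal.ofReal r := by
  have hr0 : 0 < r := ENNReal.ofReal_pos.1 (bot_le.trans_lt hr)
  obtain ⟨M, hM⟩ := exists_truncPot_lt hS hμ hr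
  filter_upwards [eventually_exp_mul_norm_sub_lt M z₀ (sub_pos.2 hM)] with z hz
  refine (expNegPotential_le hS hμ M z).trans_lt ((ENNReal.ofReal_lt_ofReal_iff hr0).2 ?_)
  rw [← Real.lt_log_iff_exp_lt hr0]
  have := truncPot_le_add hS hμ M z z₀
  linarith

/-- The upper envelope estimate for the node polynomials, locally uniformly in the plane. -/
lemma eventually_norm_nodePoly_le (hS : IsCompact S) (hμ : μ Sᶜ = 0) (hα : ∀ n i, α n i ∈ S)
    (hdist : HasZeroDistribution α μ) {z₀ : ℂ} {r : ℝ}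
    (hr : expNegPotential μ z₀ < ENNReal.ofReal r) :
    ∀ᶠ x : ℕ × ℂ in atTop ×ˢ 𝓝 z₀, ‖(nodePoly α x.1).eval x.2‖ ≤ r ^ x.1 := by
  have hr0 : 0 < r := ENNReal.ofReal_pos.1 (bot_le.trans_lt hr)
  obtain ⟨M, hM⟩ := exists_truncPot_lt hS hμ hr
  -- The gap below `log r` is split: the part up to `t` absorbs the error of weak-star convergence
  -- at `z₀`, the rest the Lipschitz error of moving from `z₀` to `z`.
  obtain ⟨t, ht1, ht2⟩ := exists_between hM
  have h1 := (tendsto_average hS hμ hα hdist (continuous_truncLog_norm M z₀)).eventually_lt_const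
    ht1
  have h2 := eventually_exp_mul_norm_sub_lt M z₀ (sub_pos.2 ht2)
  filter_upwards [(h1.and (eventually_gt_atTop 0)).prod_mk h2] with ⟨n, z⟩ ⟨⟨hn, hn0⟩, hz⟩
  refine (norm_eval_nodePoly_le M n z).trans ?_
  dsimp only at *
  rw [← exp_nat_mul_log hr0]
  refine Real.exp_le_exp.2 ((sum_truncLog_le M n z z₀).trans ?_)
  have hn0' : (0 : ℝ) < n := by exact_mod_cast hn0
  rw [inv_mul_lt_iff₀ hn0'] at hn
  nlinarith

lemma eventually_exp_neg_le (hS : IsCompact S) (hμ : μ Sᶜ = 0) {z₀ : ℂ} (hz₀ : z₀ ∉ S) :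
    ∃ M : ℕ, ∀ᶠ z in 𝓝 z₀, ∀ ζ ∈ S, Real.exp (-M) ≤ ‖z - ζ‖ := by
  have hpos := infDist_pos_of_notMem hS hμ hz₀
  obtain ⟨M, hM⟩ := exists_exp_neg_le (half_pos hpos)
  refine ⟨M, ?_⟩
  have := (Metric.continuous_infDist_pt S).tendsto z₀
  filter_upwards [this.eventually_const_lt (half_lt_self hpos)] with z hz ζ hζ
  exact hM.trans (hz.le.trans (infDist_le_norm_sub hζ))

/-- Off `S` a single truncation computes `u` on a whole neighbourhood, so `u` is continuous there.
On `S` only upper semicontinuity is available. -/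
lemma eventually_lt_expNegPotential (hS : IsCompact S) (hμ : μ Sᶜ = 0) {z₀ : ℂ} (hz₀ : z₀ ∉ S)
    {r : ℝ} (hr : ENNReal.ofReal r < expNegPotential μ z₀) :
    ∀ᶠ z in 𝓝 z₀, ENNReal.ofReal r < expNegPotential μ z := by
  obtain ⟨M, hM⟩ := eventually_exp_neg_le hS hμ hz₀
  rw [expNegPotential_eq hS hμ hM.self_of_nhds,
    ENNReal.ofReal_lt_ofReal_iff (Real.exp_pos _)] at hr
  have hc : Continuous (truncPot μ M) := by
    refine LipschitzWith.continuous (K := (Real.exp M).toNNReal) (LipschitzWith.of_le_add_mul _ ?_)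
    intro x y
    rw [Real.coe_toNNReal _ (Real.exp_pos _).le, dist_eq_norm]
    exact truncPot_le_add hS hμ M x y
  filter_upwards [hM, (Real.continuous_exp.comp hc).tendsto z₀ |>.eventually_const_lt hr]
    with z hz hz2
  rw [expNegPotential_eq hS hμ hz, ENNReal.ofReal_lt_ofReal_iff (Real.exp_pos _)]
  exact hz2

/-- The lower estimate for the node polynomials, locally uniformly off the support. -/
lemma eventually_le_norm_nodePoly (hS : IsCompact S) (hμ : μ Sᶜ = 0) (hα : ∀ n i, α n i ∈ S)
    (hdist : HasZeroDistribution α μ) {z₀ : ℂ} (hz₀ : z₀ ∉ S) {r : ℝ} (hr0 : 0 < r)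
    (hr : ENNReal.ofReal r < expNegPotential μ z₀) :
    ∀ᶠ x : ℕ × ℂ in atTop ×ˢ 𝓝 z₀, r ^ x.1 ≤ ‖(nodePoly α x.1).eval x.2‖ := by
  obtain ⟨M, hM⟩ := eventually_exp_neg_le hS hμ hz₀
  rw [expNegPotential_eq hS hμ hM.self_of_nhds,
    ENNReal.ofReal_lt_ofReal_iff (Real.exp_pos _), ← Real.log_lt_iff_lt_exp hr0] at hr
  obtain ⟨t, ht1, ht2⟩ := exists_between hr
  have h1 := (tendsto_average hS hμ hα hdist (continuous_truncLog_norm M z₀)).eventually_const_lt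
    ht2
  have h2 := eventually_exp_mul_norm_sub_lt M z₀ (sub_pos.2 ht1)
  filter_upwards [(h1.and (eventually_gt_atTop 0)).prod_mk (h2.and hM)]
    with ⟨n, z⟩ ⟨⟨hn, hn0⟩, hz, hzM⟩
  dsimp only at *
  rw [norm_eval_nodePoly_eq fun i => hzM _ (hα n i), ← exp_nat_mul_log hr0]
  refine Real.exp_le_exp.2 ?_
  have h3 := sum_truncLog_le (α := α) M n z₀ z
  have hn0' : (0 : ℝ) < n := by exact_mod_cast hn0
  rw [lt_inv_mul_iff₀ hn0'] at hn
  rw [norm_sub_rev] at h3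
  nlinarith

end Nodes

/-! ### Cauchy integrals with smooth cutoff functions -/

/-- Twice the Cauchy–Riemann operator `∂/∂z̄`. -/
def dbar (φ : ℂ → ℂ) (t : ℂ) : ℂ :=
  fderiv ℝ φ t 1 + Complex.I * fderiv ℝ φ t Complex.I

lemma continuous_dbar {φ : ℂ → ℂ} (hφ : ContDiff ℝ 1 φ) : Continuous (dbar φ) := by
  have h := hφ.continuous_fderiv one_ne_zero
  unfold dbar
  fun_prop

lemma dbar_eq_zero_of_eventuallyEq_const {φ : ℂ → ℂ} {t c : ℂ} (h : φ =ᶠ[𝓝 t] fun _ => c) :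
    dbar φ t = 0 := by
  simp [dbar, h.fderiv_eq]

lemma dbar_eq_zero_of_notMem_tsupport {φ : ℂ → ℂ} {t : ℂ} (h : t ∉ tsupport φ) :
    dbar φ t = 0 :=
  dbar_eq_zero_of_eventuallyEq_const (notMem_tsupport_iff_eventuallyEq.1 h)

lemma hasCompactSupport_dbar {φ : ℂ → ℂ} (hφ : HasCompactSupport φ) :
    HasCompactSupport (dbar φ) :=
  HasCompactSupport.intro hφ fun _ h => dbar_eq_zero_of_notMem_tsupport h

lemma dbar_sub {φ ψ : ℂ → ℂ} {t : ℂ} (hφ : DifferentiableAt ℝ φ t) (hψ : DifferentiableAt ℝ ψ t) :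
    dbar (φ - ψ) t = dbar φ t - dbar ψ t := by
  simp only [dbar, fderiv_sub hφ hψ, _root_.sub_apply]
  ring

/-- Integration by parts against the constant function `1`. -/
lemma integral_dbar {φ : ℂ → ℂ} (hφ : ContDiff ℝ 1 φ) (hc : HasCompactSupport φ) :
    ∫ t, dbar φ t = 0 := by
  have hcont := hφ.continuous_fderiv one_ne_zero
  have hi (v : ℂ) : Integrable fun t => fderiv ℝ φ t v :=
    (by fun_prop : Continuous fun t => fderiv ℝ φ t v).integrable_of_hasCompactSupport
      (hc.fderiv_apply ℝ v)
  have key (v : ℂ) : ∫ t, fderiv ℝ φ t v = 0 := by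
    have := integral_mul_fderiv_eq_neg_fderiv_mul_of_integrable (𝕜 := ℂ) (μ := volume)
      (f := fun _ : ℂ => (1 : ℂ)) (g := φ) (v := v) (by simp) (by simpa using hi v)
      (by simpa using hφ.continuous.integrable_of_hasCompactSupport hc)
      (fun _ _ => differentiableAt_const _)
      (fun x _ => (hφ.differentiable one_ne_zero) x)
    simpa using this
  unfold dbar
  rw [integral_add (hi 1) ((hi _).const_mul _), integral_const_mul, key, key]
  simp

/-- The Cauchy–Riemann equation for `g` removes the second term of the product rule. -/
lemma dbar_mul {χ g : ℂ → ℂ} {t : ℂ} (hχ : DifferentiableAt ℝ χ t) (hg : DifferentiableAt ℂ g t) :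
    dbar (χ * g) t = dbar χ t * g t := by
  have hg' := hg.hasFDerivAt.restrictScalars ℝ
  have h := (hχ.hasFDerivAt.mul hg').fderiv
  have h1 : fderiv ℂ g t Complex.I = Complex.I * fderiv ℂ g t 1 := by
    rw [← smul_eq_mul, ← map_smul, smul_eq_mul, mul_one]
  simp only [dbar, h, _root_.add_apply, _root_.smul_apply,
    ContinuousLinearMap.coe_restrictScalars', h1, smul_eq_mul]
  linear_combination (χ t * fderiv ℂ g t 1) * Complex.I_mul_I

/-- A cutoff function with values in `ℂ`. -/
structure IsCutoff (χ : ℂ → ℂ) : Prop where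
  contDiff : ContDiff ℝ 1 χ
  hasCompactSupport : HasCompactSupport χ

lemma IsCutoff.sub {χ ψ : ℂ → ℂ} (hχ : IsCutoff χ) (hψ : IsCutoff ψ) : IsCutoff (χ - ψ) :=
  ⟨hχ.contDiff.sub hψ.contDiff, hχ.hasCompactSupport.sub hψ.hasCompactSupport⟩

lemma IsCutoff.differentiableAt {χ : ℂ → ℂ} (hχ : IsCutoff χ) (t : ℂ) : DifferentiableAt ℝ χ t :=
  hχ.contDiff.differentiable one_ne_zero t

/-- Cauchy's theorem in cutoff form: the integrand is `dbar (χ g)`, and `χ g` is continuously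
differentiable with compact support. -/
lemma IsCutoff.integral_dbar_mul_eq_zero {χ g : ℂ → ℂ} (hχ : IsCutoff χ)
    (hg : ∀ t ∈ tsupport χ, AnalyticAt ℂ g t) : ∫ t, dbar χ t * g t = 0 := by
  have h1 : ContDiff ℝ 1 (χ * g) := by
    rw [contDiff_iff_contDiffAt]
    intro t
    by_cases ht : t ∈ tsupport χ
    · exact hχ.contDiff.contDiffAt.mul ((hg t ht).contDiffAt.restrict_scalars ℝ)
    · have : χ * g =ᶠ[𝓝 t] fun _ => 0 := by
        filter_upwards [notMem_tsupport_iff_eventuallyEq.1 ht] with x hx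
        simp [hx]
      exact contDiffAt_const.congr_of_eventuallyEq this
  have h2 : HasCompactSupport (χ * g) := hχ.hasCompactSupport.mul_right
  rw [← integral_dbar h1 h2]
  congr 1
  ext t
  by_cases ht : t ∈ tsupport χ
  · exact (dbar_mul (hχ.differentiableAt t) (hg t ht).differentiableAt).symm
  · rw [dbar_eq_zero_of_notMem_tsupport ht, dbar_eq_zero_of_notMem_tsupport, zero_mul]
    exact fun h => ht (tsupport_mul_subset_left h)

/-- Singularities of `g` are harmless where `χ` is locally constant, since `dbar χ` vanishes nearby.
-/
lemma IsCutoff.integrable_dbar_mul {χ g : ℂ → ℂ} (hχ : IsCutoff χ)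
    (hg : ∀ t, (∃ c, χ =ᶠ[𝓝 t] fun _ => c) ∨ ContinuousAt g t) :
    Integrable fun t => dbar χ t * g t := by
  refine Continuous.integrable_of_hasCompactSupport ?_
    (hasCompactSupport_dbar hχ.hasCompactSupport).mul_right
  rw [continuous_iff_continuousAt]
  intro t
  rcases hg t with ⟨c, hc⟩ | h
  · have : (fun t => dbar χ t * g t) =ᶠ[𝓝 t] fun _ => 0 := by
      filter_upwards [hc.eventually_nhds] with x hx
      rw [dbar_eq_zero_of_eventuallyEq_const hx, zero_mul]
    exact continuousAt_const.congr this.symm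
  · exact (continuous_dbar hχ.contDiff).continuousAt.mul h

/-- A radial cutoff function, equal to `1` on the disc of centre `a` and radius `ρ`. -/
def radialCutoff (a : ℂ) (ρ : ℝ) (t : ℂ) : ℂ :=
  (Real.smoothTransition (2 - ‖t - a‖ ^ 2 / ρ ^ 2) : ℝ)

lemma radialCutoff_eq_one {a t : ℂ} {ρ : ℝ} (hρ : 0 < ρ) (h : ‖t - a‖ ≤ ρ) :
    radialCutoff a ρ t = 1 := by
  rw [radialCutoff, Real.smoothTransition.one_of_one_le, Complex.ofReal_one]
  have : ‖t - a‖ ^ 2 / ρ ^ 2 ≤ 1 := by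
    rw [div_le_one (by positivity)]
    gcongr
  linarith

lemma radialCutoff_eventuallyEq_one {a t : ℂ} {ρ : ℝ} (hρ : 0 < ρ) (h : ‖t - a‖ < ρ) :
    radialCutoff a ρ =ᶠ[𝓝 t] fun _ => 1 := by
  have hc : Continuous fun x : ℂ => ‖x - a‖ := by fun_prop
  filter_upwards [hc.continuousAt.eventually_lt_const h] with x hx
  exact radialCutoff_eq_one hρ hx.le

lemma radialCutoff_eq_zero {a t : ℂ} {ρ : ℝ} (hρ : 0 < ρ) (h : 2 * ρ ≤ ‖t - a‖) :
    radialCutoff a ρ t = 0 := by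
  rw [radialCutoff, Real.smoothTransition.zero_of_nonpos, Complex.ofReal_zero]
  have : 2 ≤ ‖t - a‖ ^ 2 / ρ ^ 2 := by
    rw [le_div_iff₀ (by positivity)]
    nlinarith
  linarith

lemma isCutoff_radialCutoff (a : ℂ) {ρ : ℝ} (hρ : 0 < ρ) : IsCutoff (radialCutoff a ρ) where
  contDiff := by
    unfold radialCutoff
    refine Complex.ofRealCLM.contDiff.comp ?_
    refine (Real.smoothTransition.contDiff (n := 1)).comp ?_
    have : ContDiff ℝ 1 fun t : ℂ => ‖t - a‖ ^ 2 := (contDiff_id.sub contDiff_const).norm_sq ℝ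
    exact contDiff_const.sub (this.div_const _)
  hasCompactSupport := by
    refine HasCompactSupport.intro (isCompact_closedBall a (2 * ρ)) fun t ht => ?_
    refine radialCutoff_eq_zero hρ ?_
    rw [Metric.mem_closedBall, dist_eq_norm, not_le] at ht
    exact ht.le

/-- A real radial factor times `t - a`: division by `t - a` leaves an integrand of constant sign,
which is what shows that `cauchyConst` does not vanish. -/
lemma dbar_radialCutoff (a : ℂ) (ρ : ℝ) (t : ℂ) :
    dbar (radialCutoff a ρ) t =
      ((-(2 / ρ ^ 2 * deriv Real.smoothTransition (2 - ‖t - a‖ ^ 2 / ρ ^ 2)) : ℝ) : ℂ) * (t - a) := by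
  have h1 : HasFDerivAt (fun t : ℂ => ‖t - a‖ ^ 2)
      (2 • (innerSL ℝ (t - a)).comp (ContinuousLinearMap.id ℝ ℂ)) t :=
    ((hasFDerivAt_id t).sub_const a).norm_sq
  have h2 : HasFDerivAt (fun t : ℂ => 2 - ‖t - a‖ ^ 2 / ρ ^ 2)
      (-((ρ ^ 2)⁻¹ • (2 • (innerSL ℝ (t - a)).comp (ContinuousLinearMap.id ℝ ℂ)))) t := by
    simpa only [div_eq_mul_inv] using (h1.mul_const ((ρ ^ 2)⁻¹)).const_sub 2
  have h3 : HasDerivAt Real.smoothTransition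
      (deriv Real.smoothTransition (2 - ‖t - a‖ ^ 2 / ρ ^ 2)) (2 - ‖t - a‖ ^ 2 / ρ ^ 2) :=
    (((Real.smoothTransition.contDiff (n := 1)).differentiable (by simp)) _).hasDerivAt
  have h4 := Complex.ofRealCLM.hasFDerivAt.comp t (h3.comp_hasFDerivAt t h2)
  have h5 : fderiv ℝ (radialCutoff a ρ) t = _ := h4.fderiv
  rw [dbar, h5]
  simp only [ContinuousLinearMap.comp_apply, _root_.smul_apply,
    _root_.neg_apply, innerSL_apply_apply, Complex.ofRealCLM_apply,
    ContinuousLinearMap.id_apply, smul_eq_mul]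
  have e1 : inner ℝ (t - a) (1 : ℂ) = (t - a).re := by simp [Complex.inner]
  have e2 : inner ℝ (t - a) Complex.I = (t - a).im := by
    simp [Complex.inner]
    ring
  simp only [e1, e2]
  generalize deriv Real.smoothTransition (2 - ‖t - a‖ ^ 2 / ρ ^ 2) = D
  conv_rhs => rw [← Complex.re_add_im (t - a)]
  push_cast
  ring

lemma continuous_deriv_smoothTransition : Continuous (deriv Real.smoothTransition) :=
  (Real.smoothTransition.contDiff (n := 1)).continuous_deriv (by simp)

/-- The constant of the Cauchy formula. -/
def cauchyConst : ℂ :=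
  ∫ t, dbar (radialCutoff 0 1) t * t⁻¹

lemma cauchyConst_ne_zero : cauchyConst ≠ 0 := by
  let G : ℂ → ℝ := fun t => 2 * deriv Real.smoothTransition (2 - ‖t‖ ^ 2)
  have hG : cauchyConst = ((-∫ t, G t : ℝ) : ℂ) := by
    rw [← integral_neg, ← integral_complex_ofReal, cauchyConst]
    refine integral_congr_ae ?_
    have : ∀ᵐ t : ℂ, t ≠ 0 := by simp [ae_iff, measure_singleton]
    filter_upwards [this] with t ht
    rw [dbar_radialCutoff]
    simp [G, ht]
  rw [hG, Complex.ofReal_ne_zero, neg_ne_zero]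
  have hc : Continuous G := by
    have := continuous_deriv_smoothTransition
    fun_prop
  -- The transition rises from `0` to `1` on `[0, 1]`, so its derivative equals `1` at some `x`. The
  -- point `√(2 - x)` then has `2 - ‖t‖ ^ 2 = x`, and `G` is positive there.
  obtain ⟨x, hx, hx'⟩ := exists_deriv_eq_slope Real.smoothTransition (a := 0) (b := 1) one_pos
    Real.smoothTransition.continuous.continuousOn
    ((Real.smoothTransition.contDiff (n := 1)).differentiable (by simp)).differentiableOn
  rw [Real.smoothTransition.one, Real.smoothTransition.zero] at hx'
  refine (hc.integral_pos_of_hasCompactSupport_nonneg_nonzero (x := ((√(2 - x) : ℝ) : ℂ)) ?_ ?_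
    ?_).ne'
  · refine HasCompactSupport.intro (isCompact_closedBall 0 2) fun t ht => ?_
    rw [mem_closedBall_zero_iff, not_le] at ht
    have : Real.smoothTransition =ᶠ[𝓝 (2 - ‖t‖ ^ 2)] fun _ => 0 := by
      filter_upwards [gt_mem_nhds (show 2 - ‖t‖ ^ 2 < 0 by nlinarith)] with y hy
      exact Real.smoothTransition.zero_of_nonpos (le_of_lt hy)
    simp [G, this.deriv_eq]
  · intro t
    have := Real.smoothTransition.monotone.deriv_nonneg (x := 2 - ‖t‖ ^ 2)
    simp only [Pi.zero_apply, G]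
    positivity
  · have h2 : ‖((√(2 - x) : ℝ) : ℂ)‖ ^ 2 = 2 - x := by
      rw [Complex.norm_real, Real.norm_eq_abs, sq_abs, Real.sq_sqrt (by linarith [hx.2])]
    simp only [G, h2, sub_sub_cancel, hx']
    norm_num

lemma integral_dbar_radialCutoff (z : ℂ) :
    ∫ t, dbar (radialCutoff z 1) t * (t - z)⁻¹ = cauchyConst := by
  rw [cauchyConst, ← integral_add_right_eq_self _ z]
  simp [dbar_radialCutoff]

/-- Independence of the cutoff: the difference from the radial one vanishes near `z`, the only
singularity of the kernel, so Cauchy's theorem applies to it. -/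
lemma IsCutoff.integral_dbar_mul_inv {χ : ℂ → ℂ} (hχ : IsCutoff χ) {z : ℂ}
    (hz : χ =ᶠ[𝓝 z] fun _ => 1) : ∫ t, dbar χ t * (t - z)⁻¹ = cauchyConst := by
  have hr := isCutoff_radialCutoff z one_pos
  have hz' := radialCutoff_eventuallyEq_one (a := z) (t := z) one_pos (by simp)
  have hd (t : ℂ) (ht : t ≠ z) : AnalyticAt ℂ (fun t => (t - z)⁻¹) t :=
    (analyticAt_id.sub analyticAt_const).inv (sub_ne_zero.2 ht)
  have h := (hχ.sub hr).integral_dbar_mul_eq_zero (g := fun t => (t - z)⁻¹) fun t ht => by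
    refine hd t ?_
    rintro rfl
    refine notMem_tsupport_iff_eventuallyEq.2 ?_ ht
    filter_upwards [hz, hz'] with x h1 h2
    simp [h1, h2]
  have hi {ψ : ℂ → ℂ} (hψ : IsCutoff ψ) (hz : ψ =ᶠ[𝓝 z] fun _ => 1) :
      Integrable fun t => dbar ψ t * (t - z)⁻¹ := by
    refine hψ.integrable_dbar_mul fun t => ?_
    by_cases ht : t = z
    · exact .inl ⟨1, ht ▸ hz⟩
    · exact .inr (hd t ht).continuousAt
  simp only [dbar_sub (hχ.differentiableAt _) (hr.differentiableAt _), sub_mul] at h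
  rw [integral_sub (hi hχ hz) (hi hr hz'), sub_eq_zero] at h
  rw [h, integral_dbar_radialCutoff]

/-- **Cauchy's formula** with a smooth cutoff function in place of a contour. -/
lemma IsCutoff.integral_dbar_mul_cauchy {χ h : ℂ → ℂ} (hχ : IsCutoff χ) {Ω : Set ℂ} (hΩ : IsOpen Ω)
    (hsupp : tsupport χ ⊆ Ω) (hh : DifferentiableOn ℂ h Ω) {z : ℂ} (hzΩ : z ∈ Ω)
    (hz : χ =ᶠ[𝓝 z] fun _ => 1) :
    ∫ t, dbar χ t * (h t * (t - z)⁻¹) = cauchyConst * h z := by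
  have hds : DifferentiableOn ℂ (dslope h z) Ω :=
    (Complex.differentiableOn_dslope (hΩ.mem_nhds hzΩ)).2 hh
  have h0 := hχ.integral_dbar_mul_eq_zero (g := dslope h z) fun t ht =>
    hds.analyticAt (hΩ.mem_nhds (hsupp ht))
  have h1 : ∀ t, dbar χ t * (h t * (t - z)⁻¹) =
      dbar χ t * dslope h z t + dbar χ t * (t - z)⁻¹ * h z := by
    intro t
    by_cases ht : t = z
    · rw [ht, dbar_eq_zero_of_eventuallyEq_const hz]
      simp
    · rw [dslope_of_ne _ ht, slope_def_field]
      field_simp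
      ring
  simp only [h1]
  rw [integral_add, h0, zero_add, integral_mul_const, hχ.integral_dbar_mul_inv hz]
  · refine hχ.integrable_dbar_mul fun t => ?_
    by_cases ht : t ∈ tsupport χ
    · exact .inr (hds.continuousOn.continuousAt (hΩ.mem_nhds (hsupp ht)))
    · exact .inl ⟨0, notMem_tsupport_iff_eventuallyEq.1 ht⟩
  · refine Integrable.mul_const (hχ.integrable_dbar_mul fun t => ?_) _
    by_cases ht : t = z
    · exact .inl ⟨1, ht ▸ hz⟩
    · exact .inr (ContinuousAt.inv₀ (by fun_prop) (sub_ne_zero.2 ht))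

lemma exists_norm_dbar_radialCutoff_le :
    ∃ B : ℝ, 0 ≤ B ∧ ∀ ρ : ℝ, 0 < ρ → ∀ t, ‖dbar (radialCutoff 0 ρ) t‖ ≤ B / ρ := by
  obtain ⟨B, hB⟩ := (isCompact_Icc (a := (-2 : ℝ)) (b := 2)).exists_bound_of_continuousOn
    continuous_deriv_smoothTransition.continuousOn
  have hB0 : 0 ≤ B := (norm_nonneg _).trans (hB 0 (by norm_num))
  refine ⟨4 * B, by positivity, fun ρ hρ t => ?_⟩
  by_cases ht : ‖t‖ ≤ 2 * ρ
  · rw [dbar_radialCutoff, sub_zero, norm_mul, Complex.norm_real, norm_neg, norm_mul,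
      Real.norm_of_nonneg (by positivity : 0 ≤ 2 / ρ ^ 2)]
    have h1 := hB (2 - ‖t‖ ^ 2 / ρ ^ 2) (by
      constructor
      · have : ‖t‖ ^ 2 / ρ ^ 2 ≤ 4 := by
          rw [div_le_iff₀ (by positivity)]
          nlinarith [norm_nonneg t]
        linarith
      · have : 0 ≤ ‖t‖ ^ 2 / ρ ^ 2 := by positivity
        linarith)
    calc _ ≤ 2 / ρ ^ 2 * B * (2 * ρ) := by gcongr
      _ = 4 * B / ρ := by field_simp; ring
  · rw [dbar_eq_zero_of_eventuallyEq_const (c := 0), norm_zero]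
    · positivity
    · filter_upwards [continuous_norm.continuousAt.eventually_const_lt (not_le.1 ht)] with x hx
      exact radialCutoff_eq_zero hρ (by simpa using hx.le)

/-- A function holomorphic near infinity which decays quadratically has vanishing cutoff integral. -/
lemma IsCutoff.integral_dbar_mul_eq_zero_of_decay {χ ψ : ℂ → ℂ} (hχ : IsCutoff χ) {K : Set ℂ}
    (hK : IsCompact K) (hχK : ∀ z ∈ K, χ =ᶠ[𝓝 z] fun _ => 1)
    (hψ : ∀ t ∉ K, AnalyticAt ℂ ψ t) {C ρ₀ : ℝ} (hdecay : ∀ t, ρ₀ ≤ ‖t‖ → ‖ψ t‖ ≤ C / ‖t‖ ^ 2) :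
    ∫ t, dbar χ t * ψ t = 0 := by
  obtain ⟨B, hB0, hB⟩ := exists_norm_dbar_radialCutoff_le
  obtain ⟨k, hk⟩ := hK.isBounded.exists_norm_le
  -- Since `ψ` is holomorphic off `K`, the cutoff may be exchanged for a radial one of large radius
  -- `ρ`. Then `dbar` is `O(1/ρ)`, `ψ` is `O(1/ρ²)` and the area is `O(ρ²)`, so the integral is
  -- `O(1/ρ)`.
  have hev : ∀ᶠ ρ : ℝ in atTop, ‖∫ t, dbar χ t * ψ t‖ ≤ B * (|C| * (4 * Real.pi)) * ρ⁻¹ := by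
    filter_upwards [eventually_gt_atTop 0, eventually_gt_atTop k, eventually_ge_atTop ρ₀]
      with ρ hρ hρk hρ0
    have hr := isCutoff_radialCutoff 0 hρ
    have hrK : ∀ z ∈ K, radialCutoff 0 ρ =ᶠ[𝓝 z] fun _ => 1 := fun z hz =>
      radialCutoff_eventuallyEq_one hρ (by simpa using (hk z hz).trans_lt hρk)
    have h := (hχ.sub hr).integral_dbar_mul_eq_zero (g := ψ) fun t ht => by
      refine hψ t fun htK => notMem_tsupport_iff_eventuallyEq.2 ?_ ht
      filter_upwards [hχK t htK, hrK t htK] with x h1 h2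
      simp [h1, h2]
    have hi {φ : ℂ → ℂ} (hφ : IsCutoff φ) (hz : ∀ z ∈ K, φ =ᶠ[𝓝 z] fun _ => 1) :
        Integrable fun t => dbar φ t * ψ t := by
      refine hφ.integrable_dbar_mul fun t => ?_
      by_cases ht : t ∈ K
      · exact .inl ⟨1, hz t ht⟩
      · exact .inr (hψ t ht).continuousAt
    simp only [dbar_sub (hχ.differentiableAt _) (hr.differentiableAt _), sub_mul] at h
    rw [integral_sub (hi hχ hχK) (hi hr hrK), sub_eq_zero] at h
    rw [h, ← setIntegral_eq_integral_of_forall_compl_eq_zero (s := Metric.closedBall 0 (2 * ρ))]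
    · refine (norm_setIntegral_le_of_norm_le_const (C := B / ρ * (|C| / ρ ^ 2))
        measure_closedBall_lt_top fun t _ => ?_).trans (le_of_eq ?_)
      · by_cases ht : ‖t‖ < ρ
        · rw [dbar_eq_zero_of_eventuallyEq_const
            (radialCutoff_eventuallyEq_one hρ (by simpa using ht)), zero_mul, norm_zero]
          positivity
        · rw [not_lt] at ht
          rw [norm_mul]
          gcongr
          · exact hB ρ hρ t
          · refine (hdecay t (hρ0.trans ht)).trans ?_
            gcongr
            exact le_abs_self C
      · rw [Measure.real, Complex.volume_closedBall, ENNReal.toReal_mul, ENNReal.toReal_pow,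
          ENNReal.toReal_ofReal (by positivity)]
        simp only [ENNReal.coe_toReal, NNReal.coe_real_pi]
        field_simp
        ring
    · intro t ht
      rw [mem_closedBall_zero_iff, not_le] at ht
      rw [dbar_eq_zero_of_notMem_tsupport, zero_mul]
      rw [notMem_tsupport_iff_eventuallyEq]
      filter_upwards [continuous_norm.continuousAt.eventually_const_lt ht] with x hx
      exact radialCutoff_eq_zero hρ (by simpa using hx.le)
  have hlim : Tendsto (fun ρ : ℝ => B * (|C| * (4 * Real.pi)) * ρ⁻¹) atTop (𝓝 0) := by
    simpa using tendsto_inv_atTop_zero.const_mul (B * (|C| * (4 * Real.pi)))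
  exact norm_le_zero_iff.1 (ge_of_tendsto hlim hev)

lemma exists_isCutoff {K Ω : Set ℂ} (hK : IsCompact K) (hΩ : IsOpen Ω) (hKΩ : K ⊆ Ω) :
    ∃ χ : ℂ → ℂ, IsCutoff χ ∧ tsupport χ ⊆ Ω ∧ ∀ z ∈ K, χ =ᶠ[𝓝 z] fun _ => 1 := by
  obtain ⟨L, hL, hKL, hLΩ⟩ := exists_compact_between hK hΩ hKΩ
  obtain ⟨f, hf0, hf1, -⟩ := exists_contMDiffMap_zero_one_nhds_of_isClosed (n := 1)
    (modelWithCornersSelf ℝ ℂ)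
    (isOpen_interior (s := L)).isClosed_compl hK.isClosed
    (Set.disjoint_left.2 fun x hx hxK => hx (hKL hxK))
  rw [eventually_nhdsSet_iff_forall] at hf0 hf1
  have hsupp : tsupport (fun z => (f z : ℂ)) ⊆ L := by
    intro z hz
    by_contra hzL
    refine notMem_tsupport_iff_eventuallyEq.2 ?_ hz
    filter_upwards [hf0 z fun h => hzL (interior_subset h)] with x hx
    simp [hx]
  refine ⟨fun z => (f z : ℂ), ⟨?_, ?_⟩, hsupp.trans hLΩ, fun z hz => ?_⟩
  · exact Complex.ofRealCLM.contDiff.comp f.contMDiff.contDiff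
  · exact hL.of_isClosed_subset (isClosed_tsupport _) hsupp
  · filter_upwards [hf1 z hz] with x hx
    simp [hx]

/-! ### The Hermite remainder estimate -/

lemma norm_eval_le_of_coeff_le {Q : ℂ[X]} {m : ℕ} {B T : ℝ} (hQ : Q.natDegree ≤ m)
    (hB : ∀ j, ‖Q.coeff j‖ ≤ B) (hT : 1 ≤ T) {t : ℂ} (ht : ‖t‖ ≤ T) :
    ‖Q.eval t‖ ≤ B * ((m + 1) * T ^ m) := by
  rw [eval_eq_sum_range' (Nat.lt_succ_of_le hQ)]
  have hB0 : 0 ≤ B := (norm_nonneg _).trans (hB 0)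
  have hle : ∀ j ∈ Finset.range (m + 1), ‖Q.coeff j * t ^ j‖ ≤ B * T ^ m := fun j hj => by
    rw [norm_mul, norm_pow]
    gcongr
    · exact hB j
    · calc ‖t‖ ^ j ≤ T ^ j := by gcongr
        _ ≤ T ^ m := pow_le_pow_right₀ hT (Nat.lt_succ_iff.1 (Finset.mem_range.1 hj))
  refine (norm_sum_le_of_le _ hle).trans (le_of_eq ?_)
  simp
  ring

lemma exists_coeff_le (Q : ℂ[X]) : ∃ B : ℝ, 0 ≤ B ∧ ∀ j, ‖Q.coeff j‖ ≤ B := by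
  refine ⟨∑ j ∈ Q.support, ‖Q.coeff j‖, Finset.sum_nonneg fun _ _ => norm_nonneg _, fun j => ?_⟩
  by_cases hj : j ∈ Q.support
  · exact Finset.single_le_sum (f := fun j => ‖Q.coeff j‖) (fun _ _ => norm_nonneg _) hj
  · rw [notMem_support_iff.1 hj, norm_zero]
    exact Finset.sum_nonneg fun _ _ => norm_nonneg _

/-- Compactness turns estimates near each point of `L` into one that is uniform on `L`. -/
lemma eventually_forall_of_prod {ι X : Type*} [TopologicalSpace X] {l : Filter ι}
    {L : Set X} (hL : IsCompact L) {p : ι × X → Prop}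
    (h : ∀ x ∈ L, ∀ᶠ y in l ×ˢ 𝓝 x, p y) : ∀ᶠ i in l, ∀ x ∈ L, p (i, x) := by
  refine hL.induction_on (p := fun L => ∀ᶠ i in l, ∀ x ∈ L, p (i, x)) (by simp)
    (fun s t hst ht => ht.mono fun i hi x hx => hi x (hst hx))
    (fun s t hs ht => (hs.and ht).mono fun i hi x hx => hx.elim (hi.1 x) (hi.2 x))
    fun x hx => ?_
  obtain ⟨u, hu, v, hv, huv⟩ := Filter.eventually_prod_iff.1 (h x hx)
  exact ⟨{x | v x}, mem_nhdsWithin_of_mem_nhds hv, hu.mono fun i hi x hx => huv hi hx⟩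

section Hermite

variable {S : Set ℂ} {μ : Measure ℂ} {α : (n : ℕ) → Fin n → ℂ}

lemma half_pow_le_norm_nodePoly {k : ℝ} (hk : ∀ n i, ‖α n i‖ ≤ k) {t : ℂ} (ht : 2 * k ≤ ‖t‖)
    (n : ℕ) : (‖t‖ / 2) ^ n ≤ ‖(nodePoly α n).eval t‖ := by
  rw [eval_nodePoly, norm_prod]
  calc (‖t‖ / 2) ^ n
    _ = ∏ _i : Fin n, (‖t‖ / 2) := by
      rw [Finset.prod_const, Finset.card_univ, Fintype.card_fin]
    _ ≤ _ := Finset.prod_le_prod (fun _ _ => by positivity) fun i _ => by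
      have h1 := hk n i
      have h2 := norm_sub_norm_le t (α n i)
      linarith

variable [IsProbabilityMeasure μ]

/-- The compact set `S ∪ {u ≤ s}`. -/
def hull (S : Set ℂ) (μ : Measure ℂ) (s : ℝ) : Set ℂ :=
  S ∪ {z | expNegPotential μ z ≤ ENNReal.ofReal s}

lemma isCompact_hull (hS : IsCompact S) (hμ : μ Sᶜ = 0) (s : ℝ) : IsCompact (hull S μ s) := by
  refine Metric.isCompact_of_isClosed_isBounded ?_
    (hS.isBounded.union (isBounded_setOf_expNegPotential_le hS hμ s))
  rw [← isOpen_compl_iff, isOpen_iff_mem_nhds]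
  intro z hz
  simp only [hull, Set.mem_compl_iff, Set.mem_union, Set.mem_ofPred_eq, not_or, not_le] at hz
  filter_upwards [hS.isClosed.isOpen_compl.mem_nhds hz.1,
    eventually_lt_expNegPotential hS hμ hz.1 hz.2] with x h1 h2
  simp only [hull, Set.mem_compl_iff, Set.mem_union, Set.mem_ofPred_eq, not_or, not_le]
  exact ⟨h1, h2⟩

/-- **Hermite's estimate** for the quotient `(Q H - P) / w_{n+1}`, uniformly in all data. -/
lemma exists_hermite_bound (hS : IsCompact S) (hμ : μ Sᶜ = 0) (hα : ∀ n i, α n i ∈ S)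
    (hdist : HasZeroDistribution α μ) {s : ℝ} (hs : 0 < s) {Ω : Set ℂ} (hΩ : IsOpen Ω)
    (hKΩ : hull S μ s ⊆ Ω) {H : ℂ → ℂ} (hH : DifferentiableOn ℂ H Ω) (m : ℕ) :
    ∃ C : ℝ, 0 ≤ C ∧ ∀ᶠ n : ℕ in atTop, ∀ Q P : ℂ[X], Q.natDegree ≤ m → P.natDegree ≤ n →
      ∀ B : ℝ, (∀ j, ‖Q.coeff j‖ ≤ B) → ∀ h : ℂ → ℂ, DifferentiableOn ℂ h Ω →
      (∀ t ∈ Ω, Q.eval t * H t - P.eval t = (nodePoly α (n + 1)).eval t * h t) →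
      ∀ z ∈ hull S μ s, ‖h z‖ ≤ C * B / s ^ (n + 1) := by
  have hK := isCompact_hull hS hμ s
  have hSK : S ⊆ hull S μ s := Set.subset_union_left
  set K := hull S μ s with hKdef
  obtain ⟨χ, hχ, hχΩ, hχK⟩ := exists_isCutoff hK hΩ hKΩ
  set L := tsupport (dbar χ) with hLdef
  have hLχ : L ⊆ tsupport χ := closure_minimal (fun t ht => by
    by_contra h
    exact ht (dbar_eq_zero_of_notMem_tsupport h)) (isClosed_tsupport _)
  have hL : IsCompact L := hχ.hasCompactSupport.of_isClosed_subset (isClosed_tsupport _) hLχ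
  have hLK : Disjoint K L := Set.disjoint_left.2 fun z hz => notMem_tsupport_iff_eventuallyEq.2
    ((hχK z hz).eventually_nhds.mono fun x hx => dbar_eq_zero_of_eventuallyEq_const hx)
  obtain ⟨δ, hδ, hδKL⟩ := Metric.exists_pos_forall_lt_edist hK hL.isClosed hLK
  obtain ⟨T, hT⟩ := hL.isBounded.exists_norm_le
  obtain ⟨CH, hCH⟩ := hL.exists_bound_of_continuousOn (hH.continuousOn.mono (hLχ.trans hχΩ))
  obtain ⟨k, hk⟩ := hK.isBounded.exists_norm_le
  -- The support `L` of `dbar χ`, which plays the part of the contour, avoids the hull; so `L` lies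
  -- off `S` and `u > s` on it.
  have hlow : ∀ᶠ n : ℕ in atTop, ∀ t ∈ L, s ^ n ≤ ‖(nodePoly α n).eval t‖ :=
    eventually_forall_of_prod hL (p := fun x => s ^ x.1 ≤ ‖(nodePoly α x.1).eval x.2‖) fun t ht => by
      have htK : t ∉ K := fun h => Set.disjoint_left.1 hLK h ht
      simp only [hKdef, hull, Set.mem_union, Set.mem_ofPred_eq, not_or, not_le] at htK
      exact eventually_le_norm_nodePoly hS hμ hα hdist htK.1 hs htK.2
  set I := ∫ t, ‖dbar χ t‖ with hI
  have hI0 : 0 ≤ I := integral_nonneg fun _ => norm_nonneg _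
  set E : ℝ := (m + 1) * (max T 1) ^ m * |CH| / δ with hE
  have hE0 : 0 ≤ E := by positivity
  refine ⟨‖cauchyConst‖⁻¹ * (I * E), by positivity, ?_⟩
  filter_upwards [(tendsto_add_atTop_nat 1).eventually hlow]
    with n hn Q P hQ hP B hB h hh hid z hz
  have hB0 : 0 ≤ B := (norm_nonneg _).trans (hB 0)
  have hzΩ := hKΩ hz
  have hw : ∀ t ∉ K, (nodePoly α (n + 1)).eval t ≠ 0 := fun t ht =>
    eval_nodePoly_ne_zero hα _ fun h => ht (hSK h)
  -- As `deg P ≤ n` and `deg w_{n+1} = n + 1`, the function `P / (w_{n+1} (t - z))` decays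
  -- quadratically, and its singularities all lie in the hull.
  have hzero : ∫ t, dbar χ t * (P.eval t / (nodePoly α (n + 1)).eval t * (t - z)⁻¹) = 0 := by
    obtain ⟨A, hA0, hA⟩ := exists_coeff_le P
    refine hχ.integral_dbar_mul_eq_zero_of_decay hK hχK (fun t ht => ?_)
      (C := A * (n + 1) * 2 ^ (n + 2)) (ρ₀ := max 1 (2 * k)) fun t ht => ?_
    · refine AnalyticAt.mul (AnalyticAt.div ?_ ?_ (hw t ht)) (AnalyticAt.inv ?_ ?_)
      · exact P.differentiable.analyticAt t
      · exact (nodePoly α (n + 1)).differentiable.analyticAt t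
      · exact analyticAt_id.sub analyticAt_const
      · exact sub_ne_zero.2 fun h => ht (h ▸ hz)
    · have ht1 : 1 ≤ ‖t‖ := (le_max_left _ _).trans ht
      have ht2 : 2 * k ≤ ‖t‖ := (le_max_right _ _).trans ht
      have e1 := norm_eval_le_of_coeff_le hP hA ht1 le_rfl
      have e2 := half_pow_le_norm_nodePoly (fun n i => hk _ (hSK (hα n i))) ht2 (n + 1)
      have e3 : ‖t‖ / 2 ≤ ‖t - z‖ := by
        have h1 := hk z hz
        have h2 := norm_sub_norm_le t z
        linarith
      have ht0 : 0 < ‖t‖ := by linarith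
      rw [norm_mul, norm_div, norm_inv, ← div_eq_mul_inv, div_div]
      calc _ ≤ A * ((n + 1) * ‖t‖ ^ n) / ((‖t‖ / 2) ^ (n + 1) * (‖t‖ / 2)) := by gcongr
        _ = _ := by
          rw [div_pow]
          field_simp
          ring
  have hcauchy := hχ.integral_dbar_mul_cauchy hΩ hχΩ hh hzΩ (hχK z hz)
  have hbound : ‖∫ t, dbar χ t * (h t * (t - z)⁻¹)‖ ≤ I * (E * B / s ^ (n + 1)) := by
    have hi1 : Integrable fun t => dbar χ t * (h t * (t - z)⁻¹) := by
      refine hχ.integrable_dbar_mul fun t => ?_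
      by_cases ht : t ∈ tsupport χ
      · by_cases htz : t = z
        · exact .inl ⟨1, htz ▸ hχK z hz⟩
        · exact .inr ((hh.continuousOn.continuousAt (hΩ.mem_nhds (hχΩ ht))).mul
            (ContinuousAt.inv₀ (by fun_prop) (sub_ne_zero.2 htz)))
      · exact .inl ⟨0, notMem_tsupport_iff_eventuallyEq.1 ht⟩
    have hi2 : Integrable fun t =>
        dbar χ t * (P.eval t / (nodePoly α (n + 1)).eval t * (t - z)⁻¹) := by
      refine hχ.integrable_dbar_mul fun t => ?_
      by_cases ht : t ∈ K
      · exact .inl ⟨1, hχK t ht⟩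
      · exact .inr ((ContinuousAt.div P.continuous.continuousAt
          (nodePoly α (n + 1)).continuous.continuousAt (hw t ht)).mul
          (ContinuousAt.inv₀ (by fun_prop) (sub_ne_zero.2 fun h => ht (h ▸ hz))))
    rw [← add_zero (∫ t, dbar χ t * (h t * (t - z)⁻¹)), ← hzero, ← integral_add hi1 hi2, hI,
      ← integral_mul_const]
    have hdi : Integrable (dbar χ) := (continuous_dbar hχ.contDiff).integrable_of_hasCompactSupport
      (hasCompactSupport_dbar hχ.hasCompactSupport)
    refine norm_integral_le_of_norm_le (hdi.norm.mul_const _) (Eventually.of_forall fun t => ?_)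
    by_cases ht : t ∈ L
    · have htK : t ∉ K := fun h => Set.disjoint_left.1 hLK h ht
      have e0 := hid t (hχΩ (hLχ ht))
      -- Adding the vanishing integral replaces `h` by `Q H / w_{n+1}`, so the bound does not
      -- involve `P`.
      have e1 : dbar χ t * (h t * (t - z)⁻¹) +
          dbar χ t * (P.eval t / (nodePoly α (n + 1)).eval t * (t - z)⁻¹) =
          dbar χ t * (Q.eval t * H t / (nodePoly α (n + 1)).eval t * (t - z)⁻¹) := by
        have : h t = (Q.eval t * H t - P.eval t) / (nodePoly α (n + 1)).eval t := by
          rw [e0, mul_div_cancel_left₀ _ (hw t htK)]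
        rw [this]
        ring
      rw [e1, norm_mul, norm_mul, norm_div, norm_mul, norm_inv]
      have e2 := norm_eval_le_of_coeff_le hQ hB (le_max_right T 1)
        ((hT t ht).trans (le_max_left _ _))
      have e3 : ‖H t‖ ≤ |CH| := (hCH t ht).trans (le_abs_self _)
      have e4 := hn t ht
      have e5 : (δ : ℝ) ≤ ‖t - z‖ := by
        have := (hδKL z hz t ht).le
        rw [edist_nndist, ENNReal.coe_le_coe] at this
        rw [← dist_eq_norm, dist_comm]
        exact_mod_cast this
      have hδ' : (0 : ℝ) < δ := hδ
      refine mul_le_mul_of_nonneg_left ?_ (norm_nonneg _)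
      calc _ ≤ B * ((m + 1) * (max T 1) ^ m) * |CH| / s ^ (n + 1) * (δ : ℝ)⁻¹ := by gcongr
        _ = _ := by
          rw [hE]
          ring
    · rw [image_eq_zero_of_notMem_tsupport ht]
      simp
  rw [hcauchy, norm_mul] at hbound
  have hc : 0 < ‖cauchyConst‖ := norm_pos_iff.2 cauchyConst_ne_zero
  calc ‖h z‖ = ‖cauchyConst‖⁻¹ * (‖cauchyConst‖ * ‖h z‖) := by field_simp
    _ ≤ ‖cauchyConst‖⁻¹ * (I * (E * B / s ^ (n + 1))) := by gcongr
    _ = _ := by ring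

end Hermite

/-! ### Orders of vanishing under locally uniform limits -/

/-- By Weierstrass all derivatives converge, and vanishing to order `k` is the vanishing of the
first `k` of them. -/
lemma le_analyticOrderAt_of_tendstoLocallyUniformlyOn {ι : Type*} {l : Filter ι} [l.NeBot]
    {F : ι → ℂ → ℂ} {g : ℂ → ℂ} {U : Set ℂ} (hU : IsOpen U) {a : ℂ} (ha : a ∈ U)
    (hF : TendstoLocallyUniformlyOn F g l U) (hd : ∀ᶠ i in l, DifferentiableOn ℂ (F i) U)
    {k : ℕ} (hk : ∀ᶠ i in l, (k : ℕ∞) ≤ analyticOrderAt (F i) a) :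
    (k : ℕ∞) ≤ analyticOrderAt g a := by
  have hg : DifferentiableOn ℂ g U := hF.differentiableOn hd hU
  have key : ∀ j : ℕ, TendstoLocallyUniformlyOn (fun i => iteratedDeriv j (F i))
      (iteratedDeriv j g) l U ∧ ∀ᶠ i in l, DifferentiableOn ℂ (iteratedDeriv j (F i)) U := by
    intro j
    induction j with
    | zero => simpa using ⟨hF, hd⟩
    | succ j ih =>
      simp only [iteratedDeriv_succ]
      exact ⟨ih.1.deriv ih.2 hU, ih.2.mono fun i hi => hi.deriv hU⟩
  rw [natCast_le_analyticOrderAt_iff_iteratedDeriv_eq_zero (hg.analyticAt (hU.mem_nhds ha))]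
  intro j hj
  refine tendsto_nhds_unique ((key j).1.tendsto_at ha) ?_
  refine tendsto_const_nhds.congr' ?_
  filter_upwards [hd, hk] with i hi hik
  exact ((natCast_le_analyticOrderAt_iff_iteratedDeriv_eq_zero
    (hi.analyticAt (hU.mem_nhds ha))).1 hik j hj).symm

lemma analyticAt_eval (P : ℂ[X]) (a : ℂ) : AnalyticAt ℂ (fun z => P.eval z) a :=
  P.differentiable.analyticAt a

lemma analyticOrderAt_eval {P : ℂ[X]} (hP : P ≠ 0) (a : ℂ) :
    analyticOrderAt (fun z => P.eval z) a = P.rootMultiplicity a := by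
  obtain ⟨R, hR, hdvd⟩ := exists_eq_pow_rootMultiplicity_mul_and_not_dvd P hP a
  rw [(analyticAt_eval P a).analyticOrderAt_eq_natCast]
  refine ⟨fun z => R.eval z, analyticAt_eval R a, ?_, Eventually.of_forall fun z => ?_⟩
  · rwa [dvd_iff_isRoot] at hdvd
  · conv_lhs => rw [hR]
    simp

lemma dvd_of_rootMultiplicity_le {p q : ℂ[X]} (hp : p ≠ 0) (hq : q ≠ 0)
    (h : ∀ a, p.IsRoot a → p.rootMultiplicity a ≤ q.rootMultiplicity a) : p ∣ q := by
  rw [IsAlgClosed.dvd_iff_roots_le_roots hp hq, Multiset.le_iff_count]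
  intro a
  rw [count_roots, count_roots]
  by_cases ha : p.IsRoot a
  · exact h a ha
  · rw [rootMultiplicity_eq_zero ha]
    exact Nat.zero_le _

lemma exists_ofReal_lt_of_lt {a b : ℝ≥0∞} (h : a < b) :
    ∃ s : ℝ, 0 < s ∧ a < ENNReal.ofReal s ∧ ENNReal.ofReal s < b := by
  obtain ⟨c, hac, hcb⟩ := exists_between h
  refine ⟨c.toReal, ENNReal.toReal_pos (bot_le.trans_lt hac).ne' (hcb.trans_le le_top).ne, ?_⟩
  rw [ENNReal.ofReal_toReal (hcb.trans_le le_top).ne]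
  exact ⟨hac, hcb⟩

/-! ### Convergence of the denominators -/

section Denominators

variable {S : Set ℂ} {μ : Measure ℂ} [IsProbabilityMeasure μ] {α : (n : ℕ) → Fin n → ℂ}

/-- Under the interpolation conditions, every limit of normalized denominators is divisible by the
polynomial of the poles. -/
lemma dvd_of_tendsto_denominators (hS : IsCompact S) (hμ : μ Sᶜ = 0) (hα : ∀ n i, α n i ∈ S)
    (hdist : HasZeroDistribution α μ) {s : ℝ} (hs : 0 < s) {Ω : Set ℂ} (hΩ : IsOpen Ω)
    (hKΩ : hull S μ s ⊆ Ω) {H : ℂ → ℂ} (hH : DifferentiableOn ℂ H Ω) {m : ℕ} {q : ℂ[X]}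
    (hq0 : q ≠ 0) (hroot : ∀ a, q.IsRoot a → expNegPotential μ a < ENNReal.ofReal s ∧ H a ≠ 0)
    {N : ℕ → ℕ} (hN : Tendsto N atTop atTop) {Q P : ℕ → ℂ[X]} {h : ℕ → ℂ → ℂ}
    (hQ : ∀ᶠ k in atTop, (Q k).natDegree ≤ m) (hP : ∀ᶠ k in atTop, (q * P k).natDegree ≤ N k)
    (hQ1 : ∀ᶠ k in atTop, ∀ j, ‖(Q k).coeff j‖ ≤ 1)
    (hh : ∀ᶠ k in atTop, DifferentiableOn ℂ (h k) Ω)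
    (hid : ∀ᶠ k in atTop, ∀ t ∈ Ω, (Q k).eval t * H t - (q * P k).eval t =
      (nodePoly α (N k + 1)).eval t * h k t)
    {Qs : ℂ[X]} (hQs : Qs ≠ 0) (hQsm : Qs.natDegree ≤ m) {b : ℕ → ℝ}
    (hb : Tendsto b atTop (𝓝 0)) (hQb : ∀ k j, ‖(Q k - Qs).coeff j‖ ≤ b k) : q ∣ Qs := by
  obtain ⟨C, hC0, hC⟩ := exists_hermite_bound hS hμ hα hdist hs hΩ hKΩ hH m
  refine dvd_of_rootMultiplicity_le hq0 hQs fun a ha => ?_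
  obtain ⟨has, hHa⟩ := hroot a ha
  -- With `s'` strictly between `u(a)` and `s`, near `a` one has `|w_{N+1}| ≤ s' ^ (N+1)` against
  -- `|h| ≤ C / s ^ (N+1)`, so the product tends to `0` geometrically.
  obtain ⟨s', hs'0, has', hss'⟩ := exists_ofReal_lt_of_lt has
  rw [ENNReal.ofReal_lt_ofReal_iff hs] at hss'
  have haΩ : a ∈ Ω := hKΩ (.inr has.le)
  obtain ⟨u, hu, U₁, hU₁, huU⟩ := Filter.eventually_prod_iff.1
    (eventually_norm_nodePoly_le hS hμ hα hdist has')
  have hHc : ∀ᶠ z in 𝓝 a, ‖H z‖ < ‖H a‖ + 1 :=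
    (hH.continuousOn.continuousAt (hΩ.mem_nhds haΩ)).norm.eventually_lt_const (lt_add_one _)
  have hzc : ∀ᶠ z in 𝓝 a, ‖z‖ < ‖a‖ + 1 :=
    continuous_norm.continuousAt.eventually_lt_const (lt_add_one _)
  obtain ⟨U, hUsub, hU, haU⟩ := eventually_nhds_iff.1
    (hU₁.and (hHc.and (hzc.and ((hΩ.eventually_mem haΩ).and (eventually_expNegPotential_lt hS hμ has)))))
  set T := ‖a‖ + 1
  set D := ‖H a‖ + 1
  have hT : 1 ≤ T := by simp [T]
  have hlim : TendstoUniformlyOn (fun k z => (q * P k).eval z) (fun z => Qs.eval z * H z) atTop U := by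
    rw [Metric.tendstoUniformlyOn_iff]
    intro ε hε
    have h1 : Tendsto (fun k => b k * ((m + 1) * T ^ m) * D + C * (s' / s) ^ (N k + 1)) atTop
        (𝓝 (0 * ((m + 1) * T ^ m) * D + C * 0)) := by
      refine ((hb.mul_const _).mul_const _).add (Tendsto.const_mul _ ?_)
      have h2 := tendsto_pow_atTop_nhds_zero_of_lt_one (r := s' / s) (by positivity)
        ((div_lt_one hs).2 hss')
      exact h2.comp ((tendsto_add_atTop_nat 1).comp hN)
    rw [zero_mul, zero_mul, mul_zero, add_zero] at h1
    filter_upwards [hQ, hP, hQ1, hh, hid, hN.eventually hC, h1.eventually_lt_const hε,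
      ((tendsto_add_atTop_nat 1).comp hN).eventually hu] with k kQ kP kQ1 kh kid kC kε ku z hz
    obtain ⟨z1, z2, z3, z4, z5⟩ := hUsub z hz
    have e1 := kC (Q k) (q * P k) kQ kP 1 kQ1 (h k) kh kid z (.inr z5.le)
    have e2 : ‖(nodePoly α (N k + 1)).eval z‖ ≤ s' ^ (N k + 1) := huU ku z1
    have e3 := norm_eval_le_of_coeff_le (natDegree_sub_le_of_le kQ hQsm |>.trans (max_self m).le)
      (hQb k) hT z3.le
    have hb0 : 0 ≤ b k := (norm_nonneg _).trans (hQb k 0)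
    rw [dist_eq_norm]
    have e4 : Qs.eval z * H z - (q * P k).eval z =
        -((Q k - Qs).eval z * H z) + (nodePoly α (N k + 1)).eval z * h k z := by
      rw [← kid z z4, eval_sub]
      ring
    rw [e4]
    calc _ ≤ ‖(Q k - Qs).eval z‖ * ‖H z‖ + ‖(nodePoly α (N k + 1)).eval z‖ * ‖h k z‖ := by
          refine (norm_add_le _ _).trans ?_
          rw [norm_neg, norm_mul, norm_mul]
      _ ≤ b k * ((m + 1) * T ^ m) * D + s' ^ (N k + 1) * (C * 1 / s ^ (N k + 1)) := by
          gcongr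
      _ = b k * ((m + 1) * T ^ m) * D + C * (s' / s) ^ (N k + 1) := by
          rw [div_pow]
          ring
      _ < ε := kε
  -- Each `q P_k` vanishes at `a` at least to the order of `q`, hence so does the limit `Qs H`. As
  -- `H a ≠ 0`, the zero belongs to `Qs`.
  have hord := le_analyticOrderAt_of_tendstoLocallyUniformlyOn hU haU
    hlim.tendstoLocallyUniformlyOn (k := q.rootMultiplicity a)
    (Eventually.of_forall fun k => (q * P k).differentiable.differentiableOn)
    (Eventually.of_forall fun k => by
      by_cases h0 : q * P k = 0
      · have : analyticOrderAt (fun z => (q * P k).eval z) a = ⊤ := by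
          rw [analyticOrderAt_eq_top]
          simp [h0]
        rw [this]
        exact le_top
      · rw [analyticOrderAt_eval h0]
        exact_mod_cast rootMultiplicity_le_rootMultiplicity_of_dvd h0 (dvd_mul_right _ _) a)
  have hHan : AnalyticAt ℂ H a := hH.analyticAt (hΩ.mem_nhds haΩ)
  have hmul : analyticOrderAt (fun z => Qs.eval z * H z) a = _ :=
    analyticOrderAt_mul (analyticAt_eval Qs a) hHan
  rw [hmul, hHan.analyticOrderAt_eq_zero.2 hHa, add_zero, analyticOrderAt_eval hQs] at hord
  exact_mod_cast hord

/-- The normalized denominators converge to the polynomial of the poles. -/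
lemma tendsto_coeff_div_coeff (hS : IsCompact S) (hμ : μ Sᶜ = 0) (hα : ∀ n i, α n i ∈ S)
    (hdist : HasZeroDistribution α μ) {s : ℝ} (hs : 0 < s) {Ω : Set ℂ} (hΩ : IsOpen Ω)
    (hKΩ : hull S μ s ⊆ Ω) {H : ℂ → ℂ} (hH : DifferentiableOn ℂ H Ω) {q : ℂ[X]} (hq : q.Monic)
    (hroot : ∀ a, q.IsRoot a → expNegPotential μ a < ENNReal.ofReal s ∧ H a ≠ 0)
    {Q P : ℕ → ℂ[X]} {h : ℕ → ℂ → ℂ}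
    (hQ : ∀ n, q.natDegree ≤ n → (Q n).natDegree ≤ q.natDegree)
    (hQ0 : ∀ n, q.natDegree ≤ n → Q n ≠ 0)
    (hP : ∀ n, q.natDegree ≤ n → (q * P n).natDegree ≤ n)
    (hh : ∀ n, q.natDegree ≤ n → DifferentiableOn ℂ (h n) Ω)
    (hid : ∀ n, q.natDegree ≤ n → ∀ t ∈ Ω, (Q n).eval t * H t - (q * P n).eval t =
      (nodePoly α (n + 1)).eval t * h n t) (j : ℕ) :
    Tendsto (fun n => (Q n).coeff j / (Q n).coeff q.natDegree) atTop (𝓝 (q.coeff j)) := by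
  set m := q.natDegree with hm
  have hdeg : ∀ n, m ≤ n → ofFn (m + 1) (toFn (m + 1) (Q n)) = Q n := fun n hn =>
    ofFn_comp_toFn_eq_id_of_natDegree_lt (Nat.lt_succ_of_le (hQ n hn))
  set v : ℕ → Fin (m + 1) → ℂ := fun n => toFn (m + 1) (Q n) with hv
  have hv0 : ∀ n, m ≤ n → v n ≠ 0 := fun n hn h0 => hQ0 n hn (by
    have := hdeg n hn
    change ofFn (m + 1) (v n) = _ at this
    rw [← this, h0, map_zero])
  suffices key : Tendsto (fun n => (v n (Fin.last m))⁻¹ • v n) atTop (𝓝 (toFn (m + 1) q)) by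
    rcases lt_or_ge j (m + 1) with hj | hj
    · have := (tendsto_pi_nhds.1 key) ⟨j, hj⟩
      simpa [v, toFn, div_eq_inv_mul] using this
    · rw [coeff_eq_zero_of_natDegree_lt (n := j) (by omega)]
      refine tendsto_const_nhds.congr' ?_
      filter_upwards [eventually_ge_atTop m] with n hn
      rw [coeff_eq_zero_of_natDegree_lt ((hQ n hn).trans_lt (by omega)), zero_div]
  refine tendsto_of_subseq_tendsto fun ns hns => ?_
  -- The leading coefficient may vanish a priori, so the coefficient vectors are first normalized by
  -- their norms, which gives compactness and nonzero limits.
  set e : ℕ → Fin (m + 1) → ℂ := fun k => ((‖v (ns k)‖ : ℂ))⁻¹ • v (ns k) with he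
  have hns_m : ∀ᶠ k in atTop, m ≤ ns k := hns.eventually_ge_atTop m
  have he1 : ∀ᶠ k in atTop, e k ∈ Metric.sphere (0 : Fin (m + 1) → ℂ) 1 := by
    filter_upwards [hns_m] with k hk
    have := norm_ne_zero_iff.2 (hv0 _ hk)
    rw [mem_sphere_zero_iff_norm, he, norm_smul, norm_inv, Complex.norm_real, norm_norm]
    exact inv_mul_cancel₀ this
  obtain ⟨w, hw, ms, hms, hlim⟩ := (isCompact_sphere (0 : Fin (m + 1) → ℂ) 1).tendsto_subseq'
    he1.frequently
  refine ⟨ms, ?_⟩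
  have hw0 : w ≠ 0 := by
    rintro rfl
    simp at hw
  set Qs : ℂ[X] := ofFn (m + 1) w with hQs
  have hQs0 : Qs ≠ 0 := by
    rw [hQs, Ne, ← map_zero (ofFn (R := ℂ) (m + 1))]
    exact fun h => hw0 (injective_ofFn _ h)
  have hQsm : Qs.natDegree ≤ m := Nat.lt_succ_iff.1 (ofFn_natDegree_lt (by omega) w)
  have hNt : Tendsto (fun k => ns (ms k)) atTop atTop := hns.comp hms.tendsto_atTop
  have hNm : ∀ᶠ k in atTop, m ≤ ns (ms k) := hNt.eventually_ge_atTop m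
  have hcoeff : ∀ (x : Fin (m + 1) → ℂ) (j : ℕ), ‖(ofFn (m + 1) x).coeff j‖ ≤ ‖x‖ := fun x j => by
    rcases lt_or_ge j (m + 1) with hj | hj
    · rw [ofFn_coeff_eq_val_of_lt _ hj]
      exact norm_le_pi_norm x _
    · rw [ofFn_coeff_eq_zero_of_ge _ hj, norm_zero]
      exact norm_nonneg _
  have hQe : ∀ k, m ≤ ns (ms k) →
      ofFn (m + 1) (e (ms k)) = C ((‖v (ns (ms k))‖ : ℂ))⁻¹ * Q (ns (ms k)) := fun k hk => by
    rw [he, map_smul, hdeg _ hk, smul_eq_C_mul]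
  have hdvd : q ∣ Qs := by
    refine dvd_of_tendsto_denominators hS hμ hα hdist hs hΩ hKΩ hH hq.ne_zero hroot hNt
      (Q := fun k => ofFn (m + 1) (e (ms k)))
      (P := fun k => C ((‖v (ns (ms k))‖ : ℂ))⁻¹ * P (ns (ms k)))
      (h := fun k t => ((‖v (ns (ms k))‖ : ℂ))⁻¹ * h (ns (ms k)) t)
      (m := m) (b := fun k => ‖e (ms k) - w‖) ?_ ?_ ?_ ?_ ?_ hQs0 hQsm ?_ ?_
    · exact Eventually.of_forall fun k => Nat.lt_succ_iff.1 (ofFn_natDegree_lt (by omega) _)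
    · filter_upwards [hNm] with k hk
      rw [mul_left_comm]
      exact (natDegree_C_mul_le _ _).trans (hP _ hk)
    · filter_upwards [hms.tendsto_atTop.eventually he1] with k hk j
      exact (hcoeff _ j).trans (mem_sphere_zero_iff_norm.1 hk).le
    · filter_upwards [hNm] with k hk
      exact (hh _ hk).const_mul _
    · filter_upwards [hNm] with k hk t ht
      have := hid _ hk t ht
      rw [eval_mul] at this
      rw [hQe k hk]
      simp only [eval_mul, eval_C]
      linear_combination ((‖v (ns (ms k))‖ : ℂ))⁻¹ * this
    · exact tendsto_iff_norm_sub_tendsto_zero.1 hlim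
    · intro k j
      rw [hQs, ← map_sub]
      exact hcoeff _ j
  obtain ⟨p, hp⟩ := hdvd
  have hp0 : p ≠ 0 := by
    rintro rfl
    exact hQs0 (by rw [hp, mul_zero])
  -- `Qs` has degree at most `m = deg q`, so the cofactor is a constant.
  have hpdeg : p.natDegree = 0 := by
    have := hq.natDegree_mul' hp0
    rw [← hp] at this
    omega
  obtain ⟨c, rfl⟩ := natDegree_eq_zero.1 hpdeg
  have hc : c ≠ 0 := by
    rintro rfl
    exact hp0 C_0
  have hwq : w = c • toFn (m + 1) q := by
    rw [← toFn_comp_ofFn_eq_id (m + 1) w, ← hQs, hp, mul_comm, ← smul_eq_C_mul, map_smul]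
  have hlast : toFn (m + 1) q (Fin.last m) = 1 := by
    simp only [toFn, LinearMap.pi_apply, lcoeff_apply, Fin.val_last]
    exact hq.coeff_natDegree
  have hwl : w (Fin.last m) = c := by
    rw [hwq, Pi.smul_apply, hlast, smul_eq_mul, mul_one]
  have hfin : Tendsto (fun k => (e (ms k) (Fin.last m))⁻¹ • e (ms k)) atTop
      (𝓝 (toFn (m + 1) q)) := by
    have h1 : Tendsto (fun k => (e (ms k) (Fin.last m))⁻¹ • e (ms k)) atTop
        (𝓝 ((w (Fin.last m))⁻¹ • w)) :=
      (((tendsto_pi_nhds.1 hlim) (Fin.last m)).inv₀ (hwl ▸ hc)).smul hlim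
    rwa [hwl, hwq, smul_smul, inv_mul_cancel₀ hc, one_smul] at h1
  -- The norm factor cancels on division by the last coordinate.
  refine hfin.congr' ?_
  filter_upwards [hNm] with k hk
  have := norm_ne_zero_iff.2 (hv0 _ hk)
  have hne : ((‖v (ns (ms k))‖ : ℂ))⁻¹ ≠ 0 := inv_ne_zero (by exact_mod_cast this)
  simp only [he, Pi.smul_apply, smul_eq_mul, smul_smul]
  rw [mul_inv, mul_assoc, mul_left_comm, inv_mul_cancel₀ hne, mul_one]

end Denominators

/-! ### Rational functions and interpolation data -/

/-- The reduced denominator divides `Q`, so it does not vanish at `z` either, and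
cross-multiplication compares the two values. -/
lemma ratEval_div {P Q : ℂ[X]} {z : ℂ} (hQ : Q.eval z ≠ 0) :
    ratEval (algebraMap ℂ[X] (RatFunc ℂ) P / algebraMap ℂ[X] (RatFunc ℂ) Q) z =
      P.eval z / Q.eval z := by
  set R := algebraMap ℂ[X] (RatFunc ℂ) P / algebraMap ℂ[X] (RatFunc ℂ) Q with hR
  have hQ0 : Q ≠ 0 := by
    rintro rfl
    simp at hQ
  have hd : R.denom.eval z ≠ 0 := by
    intro h0
    obtain ⟨k, hk⟩ := RatFunc.denom_div_dvd P Q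
    rw [← hR] at hk
    exact hQ (by rw [hk, eval_mul, h0, zero_mul])
  have hinj := RatFunc.algebraMap_injective ℂ
  have h := RatFunc.num_div_denom R
  conv_rhs at h => rw [hR]
  rw [div_eq_div_iff (by simpa using R.denom_ne_zero) (by simpa using hQ0), ← map_mul,
    ← map_mul] at h
  have h2 := congrArg (eval z) (hinj h)
  rw [eval_mul, eval_mul] at h2
  rw [ratEval, RatFunc.eval, eval₂_id, eval₂_id, div_eq_div_iff hd hQ, h2]

/-- Numerators, denominators and quotients of the interpolation conditions. -/
structure PadeData (V : Set ℂ) (f : ℂ → ℂ) (α : (n : ℕ) → Fin n → ℂ) (m : ℕ) (Pade : ℕ → RatFunc ℂ)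
    (Q P : ℕ → ℂ[X]) (g : ℕ → ℂ → ℂ) : Prop where
  natDegree_num : ∀ n, m ≤ n → (P n).natDegree ≤ n - m
  natDegree_denom : ∀ n, m ≤ n → (Q n).natDegree ≤ m
  denom_ne_zero : ∀ n, m ≤ n → Q n ≠ 0
  differentiableOn : ∀ n, m ≤ n → DifferentiableOn ℂ (g n) V
  interpolation : ∀ n, m ≤ n → ∀ z ∈ V,
    (Q n).eval z * f z - (P n).eval z = (nodePoly α (n + 1)).eval z * g n z
  eq_div : ∀ n, m ≤ n →
    Pade n = algebraMap ℂ[X] (RatFunc ℂ) (P n) / algebraMap ℂ[X] (RatFunc ℂ) (Q n)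

section PadeData

variable {V : Set ℂ} {f : ℂ → ℂ} {α : (n : ℕ) → Fin n → ℂ} {m : ℕ} {Pade : ℕ → RatFunc ℂ}
  {Q P : ℕ → ℂ[X]} {g : ℕ → ℂ → ℂ}

lemma exists_padeData (hPade : ∀ n, m ≤ n → IsMultipointPade V f α n m (Pade n)) :
    ∃ Q P g, PadeData V f α m Pade Q P g := by
  have : ∀ n, ∃ P Q : ℂ[X], ∃ g : ℂ → ℂ, m ≤ n → P.natDegree ≤ n - m ∧ Q.natDegree ≤ m ∧ Q ≠ 0 ∧
      DifferentiableOn ℂ g V ∧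
      (∀ z ∈ V, Q.eval z * f z - P.eval z = (nodePoly α (n + 1)).eval z * g z) ∧
      Pade n = algebraMap ℂ[X] (RatFunc ℂ) P / algebraMap ℂ[X] (RatFunc ℂ) Q := by
    intro n
    by_cases hn : m ≤ n
    · obtain ⟨P, Q, h1, h2, h3, ⟨g, h4, h5⟩, h6⟩ := hPade n hn
      exact ⟨P, Q, g, fun _ => ⟨h1, h2, h3, h4, h5, h6⟩⟩
    · exact ⟨0, 0, 0, fun h => absurd h hn⟩
  choose P Q g h using this
  exact ⟨Q, P, g, fun n hn => (h n hn).1, fun n hn => (h n hn).2.1, fun n hn => (h n hn).2.2.1,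
    fun n hn => (h n hn).2.2.2.1, fun n hn => (h n hn).2.2.2.2.1,
    fun n hn => (h n hn).2.2.2.2.2⟩

lemma PadeData.smul (h : PadeData V f α m Pade Q P g) {κ : ℕ → ℂ} (hκ : ∀ n, κ n ≠ 0) :
    PadeData V f α m Pade (fun n => C (κ n) * Q n) (fun n => C (κ n) * P n)
      (fun n z => κ n * g n z) where
  natDegree_num n hn := (natDegree_C_mul_le _ _).trans (h.natDegree_num n hn)
  natDegree_denom n hn := (natDegree_C_mul_le _ _).trans (h.natDegree_denom n hn)
  denom_ne_zero n hn := mul_ne_zero (C_ne_zero.2 (hκ n)) (h.denom_ne_zero n hn)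
  differentiableOn n hn := (h.differentiableOn n hn).const_mul _
  interpolation n hn z hz := by
    simp only [eval_mul, eval_C]
    linear_combination κ n * h.interpolation n hn z hz
  eq_div n hn := by
    rw [h.eq_div n hn, map_mul, map_mul, mul_div_mul_left]
    simpa using hκ n

lemma PadeData.ratEval_eq (h : PadeData V f α m Pade Q P g) {n : ℕ} (hn : m ≤ n) {z : ℂ}
    (hz : (Q n).eval z ≠ 0) : ratEval (Pade n) z = (P n).eval z / (Q n).eval z := by
  rw [h.eq_div n hn, ratEval_div hz]

end PadeData

lemma tendsto_of_natDegree_le {ι : Type*} {l : Filter ι} {Q : ι → ℂ[X]} {q : ℂ[X]} {m : ℕ}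
    (hQ : ∀ᶠ n in l, (Q n).natDegree ≤ m) (hq : q.natDegree ≤ m)
    (h : ∀ j, Tendsto (fun n => (Q n).coeff j) l (𝓝 (q.coeff j))) (K : Set ℂ)
    (hK : Bornology.IsBounded K) :
    TendstoUniformlyOn (fun n z => (Q n).eval z) (fun z => q.eval z) l K := by
  obtain ⟨T, hT⟩ := hK.exists_norm_le
  set b : ι → ℝ := fun n => ∑ j ∈ Finset.range (m + 1), ‖q.coeff j - (Q n).coeff j‖ with hb
  have hb0 : Tendsto b l (𝓝 0) := by
    have : Tendsto b l (𝓝 (∑ j ∈ Finset.range (m + 1), ‖q.coeff j - q.coeff j‖)) :=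
      tendsto_finsetSum _ fun j _ => (tendsto_const_nhds.sub (h j)).norm
    simpa using this
  rw [Metric.tendstoUniformlyOn_iff]
  intro ε hε
  have h1 : Tendsto (fun n => b n * ((m + 1) * (max T 1) ^ m)) l (𝓝 0) := by
    simpa using hb0.mul_const ((m + 1) * (max T 1) ^ m)
  filter_upwards [hQ, h1.eventually_lt_const hε] with n hn hnε z hz
  rw [dist_eq_norm, ← eval_sub]
  refine (norm_eval_le_of_coeff_le (natDegree_sub_le_of_le hq hn |>.trans (max_self m).le)
    (fun j => ?_) (le_max_right T 1) ((hT z hz).trans (le_max_left _ _))).trans_lt hnε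
  rw [coeff_sub]
  by_cases hj : j ∈ Finset.range (m + 1)
  · exact Finset.single_le_sum (f := fun j => ‖q.coeff j - (Q n).coeff j‖)
      (fun _ _ => norm_nonneg _) hj
  · rw [Finset.mem_range, not_lt] at hj
    rw [coeff_eq_zero_of_natDegree_lt (by omega), coeff_eq_zero_of_natDegree_lt (by omega),
      sub_zero, norm_zero]
    exact Finset.sum_nonneg fun _ _ => norm_nonneg _

lemma exists_eventually_coeff_le {Q : ℕ → ℂ[X]} {q : ℂ[X]} {m : ℕ}
    (hQ : ∀ᶠ n in atTop, (Q n).natDegree ≤ m)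
    (h : ∀ j, Tendsto (fun n => (Q n).coeff j) atTop (𝓝 (q.coeff j))) :
    ∃ B : ℝ, ∀ᶠ n in atTop, ∀ j, ‖(Q n).coeff j‖ ≤ B := by
  obtain ⟨B, hB0, hB⟩ := exists_coeff_le q
  refine ⟨B + 1, ?_⟩
  have h1 : ∀ᶠ n in atTop, ∀ j ∈ Finset.range (m + 1), ‖(Q n).coeff j‖ < B + 1 := by
    rw [Filter.eventually_all_finset]
    intro j _
    exact (h j).norm.eventually_lt_const ((hB j).trans_lt (lt_add_one B))
  filter_upwards [hQ, h1] with n hn h1n j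
  by_cases hj : j ∈ Finset.range (m + 1)
  · exact (h1n j hj).le
  · rw [Finset.mem_range, not_lt] at hj
    rw [coeff_eq_zero_of_natDegree_lt (by omega), norm_zero]
    positivity

/-! ### The polynomial of the poles -/

section Poles

variable {F : ℂ → ℂ} {U : Set ℂ}

lemma poleMultiplicity_eq_zero_iff {z : ℂ} :
    poleMultiplicity F z = 0 ↔ 0 ≤ meromorphicOrderAt F z := by
  unfold poleMultiplicity
  cases h : meromorphicOrderAt F z with
  -- Infinite order means `F = 0` on a punctured neighbourhood; `untop₀` sends it to `0`, so no pole
  -- is counted.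
  | top => simp
  | coe k =>
    simp [Int.toNat_eq_zero]

lemma meromorphicOrderAt_eq_neg_poleMultiplicity {z : ℂ} (h : poleMultiplicity F z ≠ 0) :
    meromorphicOrderAt F z = ((-(poleMultiplicity F z : ℤ) : ℤ) : WithTop ℤ) := by
  unfold poleMultiplicity at *
  cases h' : meromorphicOrderAt F z with
  | top => simp [h'] at h
  | coe k =>
    simp only [h', WithTop.untop₀_coe] at h ⊢
    congr 1
    omega

lemma mem_toFinset_poles (h : HasFinitelyManyPoles F U) {a : ℂ} :
    a ∈ h.toFinset ↔ a ∈ U ∧ poleMultiplicity F a ≠ 0 :=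
  Set.Finite.mem_toFinset h

/-- The monic polynomial whose roots are the poles of `F` in `U`, with multiplicity. -/
def polePoly (h : HasFinitelyManyPoles F U) : ℂ[X] :=
  ∏ a ∈ h.toFinset, (X - C a) ^ poleMultiplicity F a

lemma monic_polePoly (h : HasFinitelyManyPoles F U) : (polePoly h).Monic :=
  monic_prod_of_monic _ _ fun a _ => (monic_X_sub_C a).pow _

lemma poleCount_eq (h : HasFinitelyManyPoles F U) :
    poleCount F U = ∑ a ∈ h.toFinset, poleMultiplicity F a := by
  refine finsum_mem_eq_sum_of_inter_support_eq _ ?_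
  ext z
  simp only [Set.mem_inter_iff, Function.mem_support, Finset.mem_coe, mem_toFinset_poles]
  tauto

lemma natDegree_polePoly (h : HasFinitelyManyPoles F U) :
    (polePoly h).natDegree = poleCount F U := by
  rw [poleCount_eq h, polePoly, natDegree_prod_of_monic _ _ fun a _ => (monic_X_sub_C a).pow _]
  simp

lemma isRoot_polePoly_iff (h : HasFinitelyManyPoles F U) {a : ℂ} :
    (polePoly h).IsRoot a ↔ a ∈ U ∧ poleMultiplicity F a ≠ 0 := by
  rw [polePoly, isRoot_prod]
  constructor
  · rintro ⟨b, hb, hab⟩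
    have hb' := (mem_toFinset_poles h).1 hb
    have : a = b := by
      rw [IsRoot.def, eval_pow, eval_sub, eval_X, eval_C] at hab
      exact sub_eq_zero.1 (pow_eq_zero_iff hb'.2 |>.1 hab)
    exact this ▸ hb'
  · intro ha
    refine ⟨a, (mem_toFinset_poles h).2 ha, ?_⟩
    simp [ha.2]

lemma rootMultiplicity_polePoly (h : HasFinitelyManyPoles F U) {a : ℂ} (ha : a ∈ U) :
    (polePoly h).rootMultiplicity a = poleMultiplicity F a := by
  classical
  have h0 : ∏ b ∈ h.toFinset, (X - C b) ^ poleMultiplicity F b ≠ 0 := (monic_polePoly h).ne_zero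
  rw [← count_roots, polePoly, roots_prod _ _ h0, Multiset.count_bind]
  simp only [roots_pow, roots_X_sub_C, Multiset.count_nsmul, Multiset.count_singleton]
  change ∑ b ∈ h.toFinset, poleMultiplicity F b * (if a = b then 1 else 0) = _
  simp only [mul_ite, mul_one, mul_zero, Finset.sum_ite_eq, mem_toFinset_poles]
  split_ifs with hm
  · rfl
  · by_contra hne
    exact hm ⟨ha, fun h => hne h.symm⟩

lemma meromorphicOrderAt_eval {q : ℂ[X]} (hq : q ≠ 0) (a : ℂ) :
    meromorphicOrderAt (fun z => q.eval z) a = ((q.rootMultiplicity a : ℤ) : WithTop ℤ) := by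
  rw [(analyticAt_eval q a).meromorphicOrderAt_eq, analyticOrderAt_eval hq]
  rfl

/-- `q F`, with removable singularities removed. -/
def clearedFun (h : HasFinitelyManyPoles F U) : ℂ → ℂ :=
  toMeromorphicNFOn ((fun z => (polePoly h).eval z) * F) U

lemma meromorphicOn_polePoly_mul (h : HasFinitelyManyPoles F U) (hF : MeromorphicNFOn F U) :
    MeromorphicOn ((fun z => (polePoly h).eval z) * F) U := fun z hz =>
  (analyticAt_eval _ z).meromorphicAt.mul (hF hz).meromorphicAt

lemma meromorphicOrderAt_clearedFun (h : HasFinitelyManyPoles F U) (hF : MeromorphicNFOn F U)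
    {z : ℂ} (hz : z ∈ U) : meromorphicOrderAt (clearedFun h) z =
      (poleMultiplicity F z : ℤ) + meromorphicOrderAt F z := by
  rw [clearedFun, meromorphicOrderAt_toMeromorphicNFOn (meromorphicOn_polePoly_mul h hF) hz,
    meromorphicOrderAt_mul (analyticAt_eval _ z).meromorphicAt (hF hz).meromorphicAt,
    meromorphicOrderAt_eval (monic_polePoly h).ne_zero, rootMultiplicity_polePoly h hz]

lemma analyticAt_clearedFun (h : HasFinitelyManyPoles F U) (hF : MeromorphicNFOn F U)
    {z : ℂ} (hz : z ∈ U) : AnalyticAt ℂ (clearedFun h) z := by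
  have hNF : MeromorphicNFAt (clearedFun h) z := meromorphicNFOn_toMeromorphicNFOn _ _ hz
  rw [← hNF.meromorphicOrderAt_nonneg_iff_analyticAt, meromorphicOrderAt_clearedFun h hF hz]
  by_cases h0 : poleMultiplicity F z = 0
  · rw [h0]
    simpa using poleMultiplicity_eq_zero_iff.1 h0
  · rw [meromorphicOrderAt_eq_neg_poleMultiplicity h0, ← WithTop.coe_add]
    simp

/-- At a pole the zero of `q` cancels the order of `F` exactly. This is what forces limits of
denominators to vanish there. -/
lemma clearedFun_ne_zero (h : HasFinitelyManyPoles F U) (hF : MeromorphicNFOn F U)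
    {z : ℂ} (hz : z ∈ U) (h0 : poleMultiplicity F z ≠ 0) : clearedFun h z ≠ 0 := by
  have hNF : MeromorphicNFAt (clearedFun h) z := meromorphicNFOn_toMeromorphicNFOn _ _ hz
  rw [← hNF.meromorphicOrderAt_eq_zero_iff, meromorphicOrderAt_clearedFun h hF hz,
    meromorphicOrderAt_eq_neg_poleMultiplicity h0, ← WithTop.coe_add]
  simp

lemma clearedFun_eq (h : HasFinitelyManyPoles F U) (hF : MeromorphicNFOn F U) {z : ℂ} (hz : z ∈ U)
    (h0 : poleMultiplicity F z = 0) : clearedFun h z = (polePoly h).eval z * F z := by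
  have hFz : AnalyticAt ℂ F z :=
    (hF hz).meromorphicOrderAt_nonneg_iff_analyticAt.1 (poleMultiplicity_eq_zero_iff.1 h0)
  rw [clearedFun, toMeromorphicNFOn_eq_toMeromorphicNFAt (meromorphicOn_polePoly_mul h hF) hz,
    toMeromorphicNFAt_eq_self.2 ((analyticAt_eval _ z).mul hFz).meromorphicNFAt]
  rfl

end Poles

/-! ### The upper estimate -/

section Upper

variable {S : Set ℂ} {μ : Measure ℂ} {V : Set ℂ} {f F : ℂ → ℂ}
  {α : (n : ℕ) → Fin n → ℂ} {R : ℝ≥0∞} {m : ℕ} {Pade : ℕ → RatFunc ℂ}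

/-- There are finitely many poles, so the maximum of `u` over them is still below `R`. -/
lemma exists_bound_roots_lt (hfin : HasFinitelyManyPoles F (sublevel μ R)) {b : ℝ≥0∞}
    (hb : b < R) : ∃ s : ℝ, 0 < s ∧ b < ENNReal.ofReal s ∧ ENNReal.ofReal s < R ∧
      ∀ a, (polePoly hfin).IsRoot a → expNegPotential μ a < ENNReal.ofReal s := by
  have hsup : hfin.toFinset.sup (expNegPotential μ) < R :=
    (Finset.sup_lt_iff (bot_le.trans_lt hb)).2 fun a ha => ((mem_toFinset_poles hfin).1 ha).1
  obtain ⟨s, hs0, hs1, hs2⟩ := exists_ofReal_lt_of_lt (max_lt hb hsup)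
  refine ⟨s, hs0, (le_max_left _ _).trans_lt hs1, hs2, fun a ha => ?_⟩
  refine ((Finset.le_sup (f := expNegPotential μ)
    ((mem_toFinset_poles hfin).2 ((isRoot_polePoly_iff hfin).1 ha))).trans
      (le_max_right b _)).trans_lt hs1

variable [IsProbabilityMeasure μ]

lemma isOpen_sublevel_ofReal (hS : IsCompact S) (hμ : μ Sᶜ = 0) (s : ℝ) :
    IsOpen (sublevel μ (ENNReal.ofReal s)) :=
  isOpen_iff_mem_nhds.2 fun _ hz => eventually_expNegPotential_lt hS hμ hz

/-- The continuation and the given germ, glued along a neighbourhood of the support. -/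
lemma exists_glued (hS : IsCompact S) (hμ : μ Sᶜ = 0) (hV : IsOpen V) (hSV : S ⊆ V)
    (hf : DifferentiableOn ℂ f V) (hα : ∀ n i, α n i ∈ S)
    (hF : IsMeromorphicContinuation S μ f R F) (hfin : HasFinitelyManyPoles F (sublevel μ R))
    {s : ℝ} (hsR : ENNReal.ofReal s < R) :
    ∃ (Ω : Set ℂ) (H : ℂ → ℂ), IsOpen Ω ∧ hull S μ s ⊆ Ω ∧ DifferentiableOn ℂ H Ω ∧
      (∀ z, expNegPotential μ z < ENNReal.ofReal s → H z = clearedFun hfin z) ∧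
      ∀ (n : ℕ) (Q P : ℂ[X]) (g : ℂ → ℂ), DifferentiableOn ℂ g V →
        (∀ z ∈ V, Q.eval z * f z - P.eval z = (nodePoly α n).eval z * g z) →
        ∃ h : ℂ → ℂ, DifferentiableOn ℂ h Ω ∧ ∀ t ∈ Ω,
          Q.eval t * H t - (polePoly hfin * P).eval t = (nodePoly α n).eval t * h t := by
  classical
  -- Agreement of `F` with `f` near `S` is only available on `E_μ(s')` with `s' < R`; taking `s' >
  -- s` makes that open set contain `{u ≤ s}`.
  obtain ⟨s', hs'0, hss', hs'R⟩ := exists_ofReal_lt_of_lt hsR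
  obtain ⟨W₀, hW₀, hSW₀, hFf⟩ := hF.2 _ hs'R
  set E := sublevel μ (ENNReal.ofReal s') with hE
  have hEo : IsOpen E := isOpen_sublevel_ofReal hS hμ s'
  have hER : E ⊆ sublevel μ R := fun z hz => lt_trans (b := ENNReal.ofReal s') hz hs'R
  set W := W₀ ∩ V with hWdef
  have hW : IsOpen W := hW₀.inter hV
  have hSW : S ⊆ W := Set.subset_inter hSW₀ hSV
  have hfW : ∀ t ∈ W, AnalyticAt ℂ f t := fun t ht => hf.analyticAt (hV.mem_nhds ht.2)
  set q := polePoly hfin with hq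
  set H : ℂ → ℂ := fun t => if t ∈ W then q.eval t * f t else clearedFun hfin t with hHdef
  have hHW : ∀ t ∈ W, H t = q.eval t * f t := fun t ht => if_pos ht
  -- On the overlap of `W` and `E` the function `F` coincides with the holomorphic `f`, so it has no
  -- pole there and both formulas for `H` agree.
  have hHE : ∀ t ∈ E, H t = clearedFun hfin t := by
    intro t ht
    by_cases htW : t ∈ W
    · have hev : F =ᶠ[𝓝 t] f := by
        filter_upwards [hW.mem_nhds htW, hEo.mem_nhds ht] with x h1 h2
        exact hFf ⟨h1.1, h2⟩
      have h0 : poleMultiplicity F t = 0 := poleMultiplicity_eq_zero_iff.2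
        ((hfW t htW).congr hev.symm).meromorphicOrderAt_nonneg
      rw [hHW t htW, clearedFun_eq hfin hF.1 (hER ht) h0, hev.self_of_nhds]
    · exact if_neg htW
  have hHWev : ∀ t ∈ W, H =ᶠ[𝓝 t] fun t => q.eval t * f t := fun t ht =>
    (hW.eventually_mem ht).mono hHW
  have hHan : ∀ t ∈ W ∪ E, AnalyticAt ℂ H t := by
    rintro t (ht | ht)
    · exact ((analyticAt_eval q t).mul (hfW t ht)).congr (hHWev t ht).symm
    · exact (analyticAt_clearedFun hfin hF.1 (hER ht)).congr
        ((hEo.eventually_mem ht).mono fun x hx => (hHE x hx).symm)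
  refine ⟨W ∪ E, H, hW.union hEo, ?_, fun t ht => (hHan t ht).differentiableAt.differentiableWithinAt,
    fun z hz => hHE z (lt_trans hz hss'), ?_⟩
  · rintro z (hz | hz)
    · exact .inl (hSW hz)
    · exact .inr (lt_of_le_of_lt (b := ENNReal.ofReal s) hz hss')
  intro n Q P g hg hid
  -- Near `S`, where `w_n` may vanish, the quotient is supplied by the interpolation condition; off
  -- `S` one may divide. The two agree on `W \ S`.
  set h : ℂ → ℂ := fun t => if t ∈ W then q.eval t * g t else
    (Q.eval t * H t - (q * P).eval t) / (nodePoly α n).eval t with hhdef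
  have hhW : ∀ t ∈ W, h t = q.eval t * g t := fun t ht => if_pos ht
  have hhS : ∀ t ∉ S, h t = (Q.eval t * H t - (q * P).eval t) / (nodePoly α n).eval t := by
    intro t ht
    by_cases htW : t ∈ W
    · rw [hhW t htW, hHW t htW, eq_div_iff (eval_nodePoly_ne_zero hα n ht), eval_mul]
      linear_combination -q.eval t * hid t htW.2
    · exact if_neg htW
  refine ⟨h, fun t ht => DifferentiableAt.differentiableWithinAt ?_, fun t ht => ?_⟩
  · by_cases htS : t ∈ S
    · have : h =ᶠ[𝓝 t] fun t => q.eval t * g t := (hW.eventually_mem (hSW htS)).mono hhW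
      exact (q.differentiableAt.mul (hg.differentiableAt (hV.mem_nhds (hSV htS)))).congr_of_eventuallyEq
        this
    · have : h =ᶠ[𝓝 t] fun t => (Q.eval t * H t - (q * P).eval t) / (nodePoly α n).eval t :=
        (hS.isClosed.isOpen_compl.eventually_mem htS).mono hhS
      exact (((Q.differentiableAt.mul (hHan t ht).differentiableAt).sub
        (q * P).differentiableAt).div (nodePoly α n).differentiableAt
        (eval_nodePoly_ne_zero hα n htS)).congr_of_eventuallyEq this
  · by_cases htS : t ∈ S
    · have htW := hSW htS
      rw [hhW t htW, hHW t htW, eval_mul]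
      linear_combination q.eval t * hid t htW.2
    · rw [hhS t htS, mul_div_cancel₀ _ (eval_nodePoly_ne_zero hα n htS)]

/-- Interpolation data may be normalized so that the denominators converge. -/
lemma exists_normalized_padeData (hS : IsCompact S) (hμ : μ Sᶜ = 0) (hV : IsOpen V) (hSV : S ⊆ V)
    (hf : DifferentiableOn ℂ f V) (hα : ∀ n i, α n i ∈ S) (hdist : HasZeroDistribution α μ)
    (hF : IsMeromorphicContinuation S μ f R F) (hR : 0 < R)
    (hfin : HasFinitelyManyPoles F (sublevel μ R))
    (hm : (polePoly hfin).natDegree = m)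
    (hPade : ∀ n, m ≤ n → IsMultipointPade V f α n m (Pade n)) :
    ∃ Q P g, PadeData V f α m Pade Q P g ∧
      ∀ j, Tendsto (fun n => (Q n).coeff j) atTop (𝓝 ((polePoly hfin).coeff j)) := by
  obtain ⟨Q, P, g, hd⟩ := exists_padeData hPade
  obtain ⟨s, hs, -, hsR, hroot⟩ := exists_bound_roots_lt hfin hR
  obtain ⟨Ω, H, hΩ, hKΩ, hH, hHc, hglue⟩ := exists_glued hS hμ hV hSV hf hα hF hfin hsR
  have : ∀ n, ∃ h : ℂ → ℂ, m ≤ n → DifferentiableOn ℂ h Ω ∧ ∀ t ∈ Ω,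
      (Q n).eval t * H t - (polePoly hfin * P n).eval t = (nodePoly α (n + 1)).eval t * h t := by
    intro n
    by_cases hn : m ≤ n
    · obtain ⟨h, hh⟩ := hglue (n + 1) (Q n) (P n) (g n) (hd.differentiableOn n hn)
        (hd.interpolation n hn)
      exact ⟨h, fun _ => hh⟩
    · exact ⟨0, fun h => absurd h hn⟩
  choose h hh using this
  subst hm
  have hlim := tendsto_coeff_div_coeff hS hμ hα hdist hs hΩ hKΩ hH (monic_polePoly hfin)
    (fun a ha => ⟨hroot a ha, by
      obtain ⟨h1, h2⟩ := (isRoot_polePoly_iff hfin).1 ha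
      rw [hHc a (hroot a ha)]
      exact clearedFun_ne_zero hfin hF.1 h1 h2⟩)
    hd.natDegree_denom hd.denom_ne_zero
    (fun n hn => natDegree_mul_le.trans (by have := hd.natDegree_num n hn; omega))
    (fun n hn => (hh n hn).1) (fun n hn => (hh n hn).2)
  classical
  -- The scaling must be nonzero for every `n`; the default `1` is irrelevant in the limit, the
  -- coefficient being eventually nonzero.
  set κ : ℕ → ℂ := fun n => if (Q n).coeff (polePoly hfin).natDegree = 0 then 1 else
    ((Q n).coeff (polePoly hfin).natDegree)⁻¹ with hκ
  refine ⟨_, _, _, hd.smul (κ := κ) fun n => ?_, fun j => ?_⟩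
  · simp only [hκ]
    split_ifs with h0
    · exact one_ne_zero
    · exact inv_ne_zero h0
  · refine (hlim j).congr' ?_
    have h1 := hlim (polePoly hfin).natDegree
    rw [(monic_polePoly hfin).coeff_natDegree] at h1
    filter_upwards [h1.eventually_ne one_ne_zero] with n hn
    have h0 : (Q n).coeff (polePoly hfin).natDegree ≠ 0 := by
      intro h0
      simp [h0] at hn
    simp only [hκ, if_neg h0, coeff_C_mul]
    rw [div_eq_inv_mul]

variable {Q P : ℕ → ℂ[X]} {g : ℕ → ℂ → ℂ}

/-- The error equals `w_{n+1} h / (q Q_n)`: Hermite's estimate bounds `h` by `s ^ -(n+1)`, the nodes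
give `η ^ (n+1)`, and `Q_n(z) → q(z) ≠ 0`. -/
lemma eventually_norm_sub_ratEval_le (hS : IsCompact S) (hμ : μ Sᶜ = 0) (hV : IsOpen V)
    (hSV : S ⊆ V) (hf : DifferentiableOn ℂ f V) (hα : ∀ n i, α n i ∈ S)
    (hdist : HasZeroDistribution α μ) (hF : IsMeromorphicContinuation S μ f R F)
    (hfin : HasFinitelyManyPoles F (sublevel μ R)) (hm : (polePoly hfin).natDegree = m)
    (hd : PadeData V f α m Pade Q P g)
    (hQ : ∀ j, Tendsto (fun n => (Q n).coeff j) atTop (𝓝 ((polePoly hfin).coeff j)))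
    {s η : ℝ} (hs : 0 < s) (hsR : ENNReal.ofReal s < R) {z : ℂ}
    (hz : z ∈ sublevel μ R) (hz0 : poleMultiplicity F z = 0)
    (hzs : expNegPotential μ z < ENNReal.ofReal s)
    (hzη : expNegPotential μ z < ENNReal.ofReal η) :
    ∃ C : ℝ, ∀ᶠ n in atTop, ‖F z - ratEval (Pade n) z‖ ≤ C * (η / s) ^ (n + 1) := by
  obtain ⟨Ω, H, hΩ, hKΩ, hH, hHc, hglue⟩ := exists_glued hS hμ hV hSV hf hα hF hfin hsR
  obtain ⟨A, hA0, hA⟩ := exists_hermite_bound hS hμ hα hdist hs hΩ hKΩ hH m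
  have hQm : ∀ᶠ n in atTop, (Q n).natDegree ≤ m :=
    (eventually_ge_atTop m).mono fun n hn => hd.natDegree_denom n hn
  obtain ⟨B, hB⟩ := exists_eventually_coeff_le hQm hQ
  have hη : 0 < η := ENNReal.ofReal_pos.1 (bot_le.trans_lt hzη)
  have hzΩ : z ∈ Ω := hKΩ (.inr hzs.le)
  set q := polePoly hfin with hq
  have hqz : q.eval z ≠ 0 := fun h => ((isRoot_polePoly_iff hfin).1 h).2 hz0
  have hqz' : 0 < ‖q.eval z‖ := norm_pos_iff.2 hqz
  have hQz : Tendsto (fun n => (Q n).eval z) atTop (𝓝 (q.eval z)) :=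
    (tendsto_of_natDegree_le hQm hm.le hQ {z} Bornology.isBounded_singleton).tendsto_at rfl
  have hw := (eventually_norm_nodePoly_le hS hμ hα hdist hzη).curry.mono
    fun n hn => hn.self_of_nhds
  refine ⟨A * B / (‖q.eval z‖ * (‖q.eval z‖ / 2)), ?_⟩
  filter_upwards [eventually_ge_atTop m, hA, hB,
    hQz.norm.eventually_const_lt (half_lt_self hqz'), (tendsto_add_atTop_nat 1).eventually hw]
    with n hn hAn hBn hQn hwn
  obtain ⟨h, hh, hid⟩ := hglue (n + 1) (Q n) (P n) (g n) (hd.differentiableOn n hn)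
    (hd.interpolation n hn)
  have hQn0 : (Q n).eval z ≠ 0 := norm_pos_iff.1 ((half_pos hqz').trans hQn)
  have e1 := hAn (Q n) (q * P n) (hd.natDegree_denom n hn)
    (natDegree_mul_le.trans (by have := hd.natDegree_num n hn; omega)) B hBn h hh hid z
    (.inr hzs.le)
  have e2 := hid z hzΩ
  rw [hHc z hzs, clearedFun_eq hfin hF.1 hz hz0, eval_mul, ← hq] at e2
  have hB0 : 0 ≤ B := (norm_nonneg _).trans (hBn 0)
  have e3 : F z - ratEval (Pade n) z =
      (nodePoly α (n + 1)).eval z * h z / (q.eval z * (Q n).eval z) := by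
    rw [hd.ratEval_eq hn hQn0, eq_div_iff (mul_ne_zero hqz hQn0), ← e2]
    field_simp
  rw [e3, norm_div, norm_mul, norm_mul]
  calc _ ≤ η ^ (n + 1) * (A * B / s ^ (n + 1)) / (‖q.eval z‖ * (‖q.eval z‖ / 2)) := by
        gcongr
    _ = _ := by
        rw [div_pow]
        ring

lemma limsup_enorm_rpow_le {x : ℕ → ℂ} {C θ : ℝ} (hθ : 0 < θ)
    (h : ∀ᶠ n in atTop, ‖x n‖ ≤ C * θ ^ (n + 1)) :
    limsup (fun n : ℕ => ‖x n‖ₑ ^ (1 / (n : ℝ))) atTop ≤ ENNReal.ofReal θ := by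
  -- Positive whatever the sign of `C`, so that `D ^ (1/n) → 1`.
  set D := max 1 (C * θ)
  have hD : 0 < D := lt_max_of_lt_left one_pos
  have hlim : Tendsto (fun n : ℕ => ENNReal.ofReal (D ^ (1 / (n : ℝ)) * θ)) atTop
      (𝓝 (ENNReal.ofReal θ)) := by
    refine ENNReal.tendsto_ofReal ?_
    have h1 : Tendsto (fun n : ℕ => 1 / (n : ℝ)) atTop (𝓝 0) := tendsto_one_div_atTop_nhds_zero_nat
    have h2 := (tendsto_const_nhds (x := D)).rpow h1 (.inl hD.ne')
    rw [Real.rpow_zero] at h2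
    simpa using h2.mul_const θ
  rw [← hlim.limsup_eq]
  refine limsup_le_limsup ?_
  filter_upwards [h, eventually_gt_atTop 0] with n hn hn0
  have hn1 : (n : ℝ) ≠ 0 := by exact_mod_cast hn0.ne'
  have e1 : ‖x n‖ ≤ D * θ ^ n := by
    refine hn.trans ?_
    rw [pow_succ', ← mul_assoc]
    gcongr
    exact le_max_right _ _
  have e2 : D ^ (1 / (n : ℝ)) * θ = (D * θ ^ n) ^ (1 / (n : ℝ)) := by
    rw [Real.mul_rpow hD.le (by positivity), ← Real.rpow_natCast θ n, ← Real.rpow_mul hθ.le,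
      mul_one_div_cancel hn1, Real.rpow_one]
  rw [e2, ← ENNReal.ofReal_rpow_of_nonneg (by positivity) (by positivity), ← ofReal_norm]
  exact ENNReal.rpow_le_rpow (ENNReal.ofReal_le_ofReal e1) (by positivity)

/-- For `c > u(z) / R` there are `s < R` with `u(z) < s c` and then `η` between `u(z)` and `s c`, so
`η / s < c`. The argument includes `R = ∞`. -/
lemma limsup_le_div (hS : IsCompact S) (hμ : μ Sᶜ = 0) (hV : IsOpen V)
    (hSV : S ⊆ V) (hf : DifferentiableOn ℂ f V) (hα : ∀ n i, α n i ∈ S)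
    (hdist : HasZeroDistribution α μ) (hF : IsMeromorphicContinuation S μ f R F)
    (hfin : HasFinitelyManyPoles F (sublevel μ R)) (hm : (polePoly hfin).natDegree = m)
    (hd : PadeData V f α m Pade Q P g)
    (hQ : ∀ j, Tendsto (fun n => (Q n).coeff j) atTop (𝓝 ((polePoly hfin).coeff j)))
    {z : ℂ} (hz : z ∈ sublevel μ R) (hz0 : poleMultiplicity F z = 0) :
    limsup (fun n : ℕ => ‖F z - ratEval (Pade n) z‖ₑ ^ (1 / (n : ℝ))) atTop ≤
      expNegPotential μ z / R := by
  have hzR : expNegPotential μ z < R := hz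
  have hR0 : R ≠ 0 := (bot_le.trans_lt hzR).ne'
  have hut := (expNegPotential_lt_top hS hμ z).ne
  refine le_of_forall_gt_imp_ge_of_dense fun c hc => ?_
  rcases eq_or_ne c ⊤ with rfl | hct
  · exact le_top
  have hc0 : c ≠ 0 := (bot_le.trans_lt hc).ne'
  rw [ENNReal.div_lt_iff (.inl hR0) (.inr hut)] at hc
  have h1 : expNegPotential μ z / c < R := by
    rwa [ENNReal.div_lt_iff (.inl hc0) (.inl hct), mul_comm]
  obtain ⟨s, hs, hs1, hsR⟩ := exists_ofReal_lt_of_lt (max_lt h1 hzR)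
  have h2 : expNegPotential μ z < ENNReal.ofReal s * c := by
    rw [← ENNReal.div_lt_iff (.inl hc0) (.inl hct)]
    exact (le_max_left _ _).trans_lt hs1
  obtain ⟨η, hη, hzη, hηs⟩ := exists_ofReal_lt_of_lt h2
  obtain ⟨C, hC⟩ := eventually_norm_sub_ratEval_le hS hμ hV hSV hf hα hdist hF hfin hm hd hQ hs hsR
    hz hz0 ((le_max_right _ _).trans_lt hs1) hzη
  refine (limsup_enorm_rpow_le (by positivity) hC).trans ?_
  rw [ENNReal.ofReal_div_of_pos hs]
  refine ENNReal.div_le_of_le_mul ?_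
  rw [mul_comm]
  exact hηs.le

end Upper

/-! ### Convergence of sequences of polynomials -/

lemma exists_tendstoUniformlyOn_of_geometric {X : Type*} {T : ℕ → X → ℂ} {K : Set X} {C θ : ℝ}
    (hθ0 : 0 ≤ θ) (hθ : θ < 1)
    (h : ∀ᶠ n in atTop, ∀ x ∈ K, ‖T (n + 1) x - T n x‖ ≤ C * θ ^ n) :
    ∃ g, TendstoUniformlyOn T g atTop K := by
  obtain ⟨N, hN⟩ := eventually_atTop.1 h
  have hstep : ∀ x ∈ K, ∀ n, dist (T (n + N) x) (T (n + 1 + N) x) ≤ C * θ ^ N * θ ^ n :=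
    fun x hx n => by
      rw [dist_comm, dist_eq_norm, add_right_comm]
      refine (hN _ (Nat.le_add_left N n) x hx).trans (le_of_eq ?_)
      ring
  have hex : ∀ x, ∃ y, x ∈ K → Tendsto (fun n => T (n + N) x) atTop (𝓝 y) := fun x => by
    by_cases hx : x ∈ K
    · obtain ⟨y, hy⟩ := cauchySeq_tendsto_of_complete
        (cauchySeq_of_le_geometric θ (C * θ ^ N) hθ (hstep x hx))
      exact ⟨y, fun _ => hy⟩
    · exact ⟨0, fun h => absurd h hx⟩
  choose g hg using hex
  refine ⟨g, ?_⟩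
  rw [Metric.tendstoUniformlyOn_iff]
  intro ε hε
  have hlim : Tendsto (fun n => C * θ ^ N * θ ^ n / (1 - θ)) atTop (𝓝 0) := by
    simpa using ((tendsto_pow_atTop_nhds_zero_of_lt_one hθ0 hθ).const_mul (C * θ ^ N)).div_const
      (1 - θ)
  have hev := (tendsto_sub_atTop_nat N).eventually (hlim.eventually_lt_const hε)
  filter_upwards [hev, eventually_ge_atTop N] with n hn hnN x hx
  have := dist_le_of_le_geometric_of_tendsto θ (C * θ ^ N) hθ (hstep x hx) (hg x hx) (n - N)
  rw [Nat.sub_add_cancel hnN] at this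
  rw [dist_comm]
  exact this.trans_lt hn

/-- By the maximum principle, uniform convergence on a circle gives it on the disc. -/
lemma uniformCauchySeqOn_closedBall {P : ℕ → ℂ[X]} {c : ℂ} {ρ : ℝ} (hρ : 0 < ρ)
    (h : UniformCauchySeqOn (fun n z => (P n).eval z) atTop (Metric.sphere c ρ)) :
    UniformCauchySeqOn (fun n z => (P n).eval z) atTop (Metric.closedBall c ρ) := by
  rw [Metric.uniformCauchySeqOn_iff] at h ⊢
  intro ε hε
  obtain ⟨N, hN⟩ := h (ε / 2) (half_pos hε)
  refine ⟨N, fun i hi j hj z hz => ?_⟩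
  rw [dist_eq_norm, ← eval_sub]
  refine lt_of_le_of_lt ?_ (half_lt_self hε)
  refine Complex.norm_le_of_forall_mem_frontier_norm_le (f := fun z => (P i - P j).eval z)
    (Metric.isBounded_ball (x := c) (r := ρ)) (P i - P j).differentiable.diffContOnCl
    (fun w hw => ?_) (by rwa [closure_ball c hρ.ne'])
  rw [frontier_ball c hρ.ne'] at hw
  have := hN i hi j hj w hw
  rw [dist_eq_norm, ← eval_sub] at this
  exact this.le

lemma exists_sphere_avoiding (q : ℂ[X]) (hq : q ≠ 0) (c : ℂ) {ε : ℝ} (hε : 0 < ε) :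
    ∃ ρ, 0 < ρ ∧ ρ < ε ∧ ∀ z ∈ Metric.sphere c ρ, q.eval z ≠ 0 := by
  classical
  obtain ⟨ρ, hρ, hρ'⟩ := (Set.Ioo_infinite hε).exists_notMem_finset
    (q.roots.toFinset.image fun a => dist a c)
  refine ⟨ρ, hρ.1, hρ.2, fun z hz h0 => hρ' ?_⟩
  rw [Finset.mem_image]
  exact ⟨z, by rw [Multiset.mem_toFinset, mem_roots hq]; exact h0, hz⟩

/-- If the denominators converge and consecutive quotients differ by geometrically small amounts
where the limit of the denominators does not vanish, the numerators converge. -/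
lemma tendstoLocallyUniformlyOn_numerators {Q P : ℕ → ℂ[X]} {q : ℂ[X]} {m : ℕ} (hq0 : q ≠ 0)
    (hQm : ∀ᶠ n in atTop, (Q n).natDegree ≤ m) (hqm : q.natDegree ≤ m)
    (hQ : ∀ j, Tendsto (fun n => (Q n).coeff j) atTop (𝓝 (q.coeff j))) {U : Set ℂ} (hU : IsOpen U)
    (hloc : ∀ c ∈ U, ∃ C θ : ℝ, 0 ≤ C ∧ 0 ≤ θ ∧ θ < 1 ∧ ∀ᶠ x : ℕ × ℂ in atTop ×ˢ 𝓝 c,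
      ‖(P (x.1 + 1)).eval x.2 * (Q x.1).eval x.2 - (P x.1).eval x.2 * (Q (x.1 + 1)).eval x.2‖ ≤
        C * θ ^ x.1) :
    ∃ p : ℂ → ℂ, TendstoLocallyUniformlyOn (fun n z => (P n).eval z) p atTop U := by
  have key : ∀ c ∈ U, ∃ ρ > 0, UniformCauchySeqOn (fun n z => (P n).eval z) atTop
      (Metric.closedBall c ρ) := by
    intro c hc
    obtain ⟨C, θ, hC, hθ0, hθ, hev⟩ := hloc c hc
    obtain ⟨u, hu, v, hv, huv⟩ := Filter.eventually_prod_iff.1 hev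
    obtain ⟨ε, hε, hεv⟩ := Metric.eventually_nhds_iff.1 hv
    -- The centre may be a zero of `q`, but a small circle avoids all zeros. There the quotients
    -- `P_n / Q_n` converge, hence so do the `P_n`, and the maximum principle fills the disc.
    obtain ⟨ρ, hρ, hρε, hρq⟩ := exists_sphere_avoiding q hq0 c hε
    refine ⟨ρ, hρ, uniformCauchySeqOn_closedBall hρ ?_⟩
    set K := Metric.sphere c ρ with hK
    have hKc : IsCompact K := isCompact_sphere c ρ
    have hKne : K.Nonempty := NormedSpace.sphere_nonempty.2 hρ.le
    obtain ⟨z₀, hz₀, hmin⟩ := hKc.exists_isMinOn hKne q.continuous.norm.continuousOn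
    set δ := ‖q.eval z₀‖ with hδdef
    have hδ : 0 < δ := norm_pos_iff.2 (hρq z₀ hz₀)
    have hQK := tendsto_of_natDegree_le hQm hqm hQ K hKc.isBounded
    have hlow : ∀ᶠ n in atTop, ∀ z ∈ K, δ / 2 ≤ ‖(Q n).eval z‖ := by
      filter_upwards [Metric.tendstoUniformlyOn_iff.1 hQK (δ / 2) (half_pos hδ)] with n hn z hz
      have h1 := hn z hz
      have h2 : δ ≤ ‖q.eval z‖ := hmin hz
      rw [dist_eq_norm] at h1
      have h3 := norm_sub_norm_le (q.eval z) ((Q n).eval z)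
      linarith
    obtain ⟨T, hT⟩ := exists_tendstoUniformlyOn_of_geometric (K := K) (C := C / (δ / 2 * (δ / 2)))
      (T := fun n z => (P n).eval z / (Q n).eval z) hθ0 hθ (by
        filter_upwards [hlow, (tendsto_add_atTop_nat 1).eventually hlow, hu] with n h1 h2 h3 z hz
        have e1 := h1 z hz
        have e2 := h2 z hz
        have e3 := huv h3 (hεv (show dist z c < ε from (Metric.mem_sphere.1 hz).trans_lt hρε))
        have n1 : (Q n).eval z ≠ 0 := norm_pos_iff.1 ((half_pos hδ).trans_le e1)
        have n2 : (Q (n + 1)).eval z ≠ 0 := norm_pos_iff.1 ((half_pos hδ).trans_le e2)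
        rw [div_sub_div _ _ n2 n1, norm_div, norm_mul]
        dsimp only at e3
        rw [mul_comm ((P n).eval z)] at e3
        calc _ ≤ C * θ ^ n / (δ / 2 * (δ / 2)) := by gcongr
          _ = _ := by ring)
    have hTc : ContinuousOn T K := hT.continuousOn (Eventually.frequently (by
      filter_upwards [hlow] with n hn
      exact (P n).continuous.continuousOn.div (Q n).continuous.continuousOn fun z hz =>
        norm_pos_iff.1 ((half_pos hδ).trans_le (hn z hz))))
    have hprod := hT.tendstoLocallyUniformlyOn.mul₀ hQK.tendstoLocallyUniformlyOn hTc
      q.continuous.continuousOn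
    rw [tendstoLocallyUniformlyOn_iff_tendstoUniformlyOn_of_compact hKc] at hprod
    refine (hprod.congr ?_).uniformCauchySeqOn
    filter_upwards [hlow] with n hn z hz
    exact div_mul_cancel₀ _ (norm_pos_iff.1 ((half_pos hδ).trans_le (hn z hz)))
  have hex : ∀ z, ∃ y, z ∈ U → Tendsto (fun n => (P n).eval z) atTop (𝓝 y) := fun z => by
    by_cases hz : z ∈ U
    · obtain ⟨ρ, hρ, h⟩ := key z hz
      obtain ⟨y, hy⟩ := cauchySeq_tendsto_of_complete
        (h.cauchySeq (Metric.mem_closedBall_self hρ.le))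
      exact ⟨y, fun _ => hy⟩
    · exact ⟨0, fun h => absurd h hz⟩
  choose p hp using hex
  refine ⟨p, ?_⟩
  rw [tendstoLocallyUniformlyOn_iff_forall_tendsto]
  intro c hc
  obtain ⟨ρ, hρ, h⟩ := key c hc
  obtain ⟨ε, hε, hεU⟩ := Metric.isOpen_iff.1 hU c hc
  have h2 : TendstoUniformlyOn (fun n z => (P n).eval z) p atTop (Metric.ball c (min ρ ε)) :=
    (h.mono (Metric.ball_subset_closedBall.trans
      (Metric.closedBall_subset_closedBall (min_le_left _ _)))).tendstoUniformlyOn_of_tendsto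
      fun z hz => hp z (hεU (Metric.ball_subset_ball (min_le_right _ _) hz))
  have h3 := h2.tendstoLocallyUniformlyOn
  rw [tendstoLocallyUniformlyOn_iff_forall_tendsto] at h3
  have h4 := h3 c (Metric.mem_ball_self (lt_min hρ hε))
  rw [(Metric.isOpen_ball).nhdsWithin_eq (Metric.mem_ball_self (lt_min hρ hε))] at h4
  exact h4.mono_left (prod_mono_right _ nhdsWithin_le_nhds)

/-! ### Consequences of the newtonian property -/

section Newtonian

variable {S V : Set ℂ} {f : ℂ → ℂ} {α : (n : ℕ) → Fin n → ℂ} {m : ℕ} {Pade : ℕ → RatFunc ℂ}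
  {Q P : ℕ → ℂ[X]} {g : ℕ → ℂ → ℂ}

lemma nodePoly_dvd (h : IsNewtonian α) {N M : ℕ} (hNM : N ≤ M) :
    nodePoly α N ∣ nodePoly α M := by
  rcases Nat.eq_zero_or_pos N with rfl | hN
  · simp [nodePoly]
  · induction M, hNM using Nat.le_induction with
    | base => exact dvd_rfl
    | succ M hM ih => exact ih.trans (h M (hN.trans_le hM))

lemma monic_nodePoly (n : ℕ) : (nodePoly α n).Monic :=
  monic_prod_of_monic _ _ fun _ _ => monic_X_sub_C _

lemma natDegree_nodePoly (n : ℕ) : (nodePoly α n).natDegree = n := by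
  rw [nodePoly, natDegree_prod_of_monic _ _ fun _ _ => monic_X_sub_C _]
  simp

lemma rootMultiplicity_nodePoly (n : ℕ) (a : ℂ) :
    (nodePoly α n).rootMultiplicity a = {i | α n i = a}.ncard := by
  classical
  have h0 : ∏ i : Fin n, (X - C (α n i)) ≠ 0 := (monic_nodePoly (α := α) n).ne_zero
  rw [← count_roots, nodePoly, roots_prod _ _ h0, Multiset.count_bind]
  simp only [roots_X_sub_C, Multiset.count_singleton]
  change ∑ i, (if a = α n i then 1 else 0) = _
  rw [Finset.sum_boole, Set.ncard_eq_toFinset_card']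
  simp [eq_comm]

lemma le_analyticOrderAt_mul_of_le {w : ℂ[X]} (hw : w ≠ 0) {k : ℂ → ℂ} {a : ℂ}
    (hk : AnalyticAt ℂ k a) :
    ((w.rootMultiplicity a : ℕ) : ℕ∞) ≤ analyticOrderAt (fun z => w.eval z * k z) a := by
  have : analyticOrderAt (fun z => w.eval z * k z) a = _ :=
    analyticOrderAt_mul (analyticAt_eval w a) hk
  rw [this, analyticOrderAt_eval hw]
  exact le_self_add

/-- Consecutive approximants differ by a constant multiple of `w_{n+1} / (Q_n Q_{n+1})`. -/
lemma PadeData.exists_sub_eq (hd : PadeData V f α m Pade Q P g) (hV : IsOpen V) (hSV : S ⊆ V)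
    (hα : ∀ n i, α n i ∈ S) (hnewton : IsNewtonian α) {n : ℕ} (hn : m ≤ n) :
    ∃ A : ℂ, P (n + 1) * Q n - P n * Q (n + 1) = C A * nodePoly α (n + 1) := by
  set T := P (n + 1) * Q n - P n * Q (n + 1) with hT
  set w := nodePoly α (n + 1) with hw
  have hw0 : w ≠ 0 := (monic_nodePoly _).ne_zero
  by_cases hT0 : T = 0
  · exact ⟨0, by rw [hT0, C_0, zero_mul]⟩
  -- With `w_{n+2} = w_{n+1} v`, eliminating `f` from the two interpolation conditions gives `T =
  -- w_{n+1} (Q_{n+1} g_n - Q_n v g_{n+1})` on `V`.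
  obtain ⟨v, hv⟩ := nodePoly_dvd hnewton (Nat.le_succ (n + 1))
  have hn' : m ≤ n + 1 := hn.trans (Nat.le_succ n)
  have hdvd : w ∣ T := by
    refine dvd_of_rootMultiplicity_le hw0 hT0 fun a ha => ?_
    have haV : a ∈ V := by
      by_contra haV
      exact eval_nodePoly_ne_zero hα _ (fun h => haV (hSV h)) ha
    have hk : AnalyticAt ℂ (fun z => (Q (n + 1)).eval z * g n z -
        (Q n).eval z * (v.eval z * g (n + 1) z)) a :=
      ((analyticAt_eval _ a).mul ((hd.differentiableOn n hn).analyticAt (hV.mem_nhds haV))).sub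
        ((analyticAt_eval _ a).mul ((analyticAt_eval _ a).mul
          ((hd.differentiableOn (n + 1) hn').analyticAt (hV.mem_nhds haV))))
    have h1 := le_analyticOrderAt_mul_of_le hw0 hk
    have h2 : (fun z => w.eval z * ((Q (n + 1)).eval z * g n z -
        (Q n).eval z * (v.eval z * g (n + 1) z))) =ᶠ[𝓝 a] fun z => T.eval z := by
      filter_upwards [hV.mem_nhds haV] with z hz
      have e1 := hd.interpolation n hn z hz
      have e2 := hd.interpolation (n + 1) hn' z hz
      rw [show nodePoly α (n + 1 + 1) = w * v from hv, eval_mul] at e2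
      rw [hT, eval_sub, eval_mul, eval_mul]
      linear_combination (Q n).eval z * e2 - (Q (n + 1)).eval z * e1
    rw [analyticOrderAt_congr h2, analyticOrderAt_eval hT0] at h1
    exact_mod_cast h1
  obtain ⟨p, hp⟩ := hdvd
  have hp0 : p ≠ 0 := by
    rintro rfl
    exact hT0 (by rw [hp, mul_zero])
  -- The larger bound comes from `P_{n+1} Q_n`, namely `(n + 1 - m) + m`, which is the degree of
  -- `w_{n+1}`.
  have hdegT : T.natDegree ≤ n + 1 := by
    refine (natDegree_sub_le_of_le (m := n + 1) (n := n + 1) ?_ ?_).trans (max_self _).le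
    · have h1 := hd.natDegree_num (n + 1) hn'
      have h2 := hd.natDegree_denom n hn
      exact natDegree_mul_le.trans (by omega)
    · have h1 := hd.natDegree_num n hn
      have h2 := hd.natDegree_denom (n + 1) hn'
      exact natDegree_mul_le.trans (by omega)
  have hpdeg : p.natDegree = 0 := by
    have := (monic_nodePoly (α := α) (n + 1)).natDegree_mul' hp0
    rw [← hw, ← hp, hw, natDegree_nodePoly] at this
    omega
  obtain ⟨A, rfl⟩ := natDegree_eq_zero.1 hpdeg
  exact ⟨A, by rw [hp, mul_comm]⟩

lemma IsLimitNode.mem (hS : IsClosed S) (hα : ∀ n i, α n i ∈ S) {ζ : ℂ} (hζ : IsLimitNode α ζ) :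
    ζ ∈ S := by
  by_contra hζS
  obtain ⟨n, hn⟩ := hζ Sᶜ (hS.isOpen_compl.mem_nhds hζS) 1
  have : {i : Fin n | α n i ∈ Sᶜ} = ∅ := by
    ext i
    simp [hα n i]
  rw [this, Set.ncard_empty] at hn
  omega

/-- At the limit points of the table, the limit of the numerators is `q f`. -/
lemma PadeData.eventuallyEq_of_isLimitNode (hd : PadeData V f α m Pade Q P g) (hV : IsOpen V)
    (hf : DifferentiableOn ℂ f V) (hα : ∀ n i, α n i ∈ S) (hSV : S ⊆ V) (hS : IsClosed S)
    (hnewton : IsNewtonian α) {q : ℂ[X]} (hqm : q.natDegree ≤ m)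
    (hQ : ∀ j, Tendsto (fun n => (Q n).coeff j) atTop (𝓝 (q.coeff j)))
    {U : Set ℂ} (hU : IsOpen U) {p : ℂ → ℂ}
    (hp : TendstoLocallyUniformlyOn (fun n z => (P n).eval z) p atTop U) {ζ : ℂ} (hζU : ζ ∈ U)
    (hζ : IsLimitNode α ζ) : p =ᶠ[𝓝 ζ] fun z => q.eval z * f z := by
  have hζV : ζ ∈ V := hSV (hζ.mem hS hα)
  obtain ⟨ε, hε, hεUV⟩ := Metric.isOpen_iff.1 (hU.inter hV) ζ ⟨hζU, hζV⟩
  set O := Metric.ball ζ ε with hO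
  have hOo : IsOpen O := Metric.isOpen_ball
  have hOV : O ⊆ V := fun z hz => (hεUV hz).2
  have hOU : O ⊆ U := fun z hz => (hεUV hz).1
  have hQm : ∀ᶠ n in atTop, (Q n).natDegree ≤ m :=
    (eventually_ge_atTop m).mono fun n hn => hd.natDegree_denom n hn
  have hQO := (tendsto_of_natDegree_le hQm hqm hQ O Metric.isBounded_ball).tendstoLocallyUniformlyOn
  have hfO : TendstoLocallyUniformlyOn (fun (_ : ℕ) => f) f atTop O :=
    TendstoUniformlyOn.tendstoLocallyUniformlyOn
      (Metric.tendstoUniformlyOn_iff.2 fun δ hδ => by simp [hδ])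
  have hlim := (hQO.mul₀ hfO q.continuous.continuousOn (hf.continuousOn.mono hOV)).sub (hp.mono hOU)
  set D : ℂ → ℂ := (fun z => q.eval z) * f - p with hD
  have hdiff : ∀ n, DifferentiableOn ℂ (((fun z => (Q n).eval z) * f) - fun z => (P n).eval z) O :=
    fun n => ((Q n).differentiable.differentiableOn.mul (hf.mono hOV)).sub
      (P n).differentiable.differentiableOn
  have hDd : DifferentiableOn ℂ D O := hlim.differentiableOn (Eventually.of_forall hdiff) hOo
  -- For `n ≥ N` the polynomial `w_N` divides `w_{n+1}`, so `Q_n f - P_n` has all zeros of `w_N` in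
  -- `O`, and the limit `D` inherits them.
  have horder : ∀ (N : ℕ), ∀ a ∈ O,
      (((nodePoly α N).rootMultiplicity a : ℕ) : ℕ∞) ≤ analyticOrderAt D a := by
    intro N a ha
    refine le_analyticOrderAt_of_tendstoLocallyUniformlyOn hOo ha hlim
      (Eventually.of_forall hdiff) ?_
    filter_upwards [eventually_ge_atTop m, eventually_ge_atTop N] with n hn hnN
    have hw0 : nodePoly α (n + 1) ≠ 0 := (monic_nodePoly _).ne_zero
    have h1 := le_analyticOrderAt_mul_of_le hw0
      ((hd.differentiableOn n hn).analyticAt (hV.mem_nhds (hOV ha)))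
    have h2 : (fun z => (nodePoly α (n + 1)).eval z * g n z) =ᶠ[𝓝 a]
        ((fun z => (Q n).eval z) * f - fun z => (P n).eval z) := by
      filter_upwards [hV.mem_nhds (hOV ha)] with z hz
      exact (hd.interpolation n hn z hz).symm
    rw [analyticOrderAt_congr h2] at h1
    refine le_trans ?_ h1
    exact_mod_cast rootMultiplicity_le_rootMultiplicity_of_dvd hw0
      (nodePoly_dvd hnewton (hnN.trans (Nat.le_succ n))) a
  have hζO : ζ ∈ O := Metric.mem_ball_self hε
  have hDan : AnalyticAt ℂ D ζ := hDd.analyticAt (hOo.mem_nhds hζO)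
  have htop : analyticOrderAt D ζ = ⊤ := by
    by_contra hne
    obtain ⟨k, hk⟩ := ENat.ne_top_iff_exists.1 hne
    have hiso : ∀ᶠ z in 𝓝 ζ, z ≠ ζ → D z ≠ 0 := by
      rcases hDan.eventually_eq_zero_or_eventually_ne_zero with h | h
      · exact absurd (analyticOrderAt_eq_top.2 h) hne
      · exact eventually_nhdsWithin_iff.1 h
    -- If `D` had finite order `k` at `ζ`, that zero would be isolated. Then `k + 1` nodes in a
    -- small neighbourhood, all being zeros of `D`, would sit at `ζ` itself and force order at least
    -- `k + 1`.
    obtain ⟨n, hn⟩ := hζ ({z | z ≠ ζ → D z ≠ 0} ∩ O) (inter_mem hiso (hOo.mem_nhds hζO)) (k + 1)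
    have hsub : {i : Fin n | α n i ∈ {z | z ≠ ζ → D z ≠ 0} ∩ O} ⊆ {i | α n i = ζ} := by
      rintro i ⟨hi1, hi2⟩
      by_contra hne'
      refine hi1 hne' ?_
      have h1 := horder n _ hi2
      have h2 : 0 < (nodePoly α n).rootMultiplicity (α n i) := by
        rw [rootMultiplicity_nodePoly, Set.ncard_pos]
        exact ⟨i, rfl⟩
      have h3 : analyticOrderAt D (α n i) ≠ 0 := by
        intro h0
        rw [h0] at h1
        have : (nodePoly α n).rootMultiplicity (α n i) ≤ 0 := by exact_mod_cast h1
        omega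
      exact (analyticOrderAt_ne_zero.1 h3).2
    have h1 := horder n ζ hζO
    rw [← hk, rootMultiplicity_nodePoly] at h1
    have h2 := Set.ncard_le_ncard hsub
    have h3 : {i : Fin n | α n i = ζ}.ncard ≤ k := by exact_mod_cast h1
    omega
  rw [analyticOrderAt_eq_top] at htop
  filter_upwards [htop] with z hz
  exact (sub_eq_zero.1 hz).symm

end Newtonian

/-! ### The lower estimate -/

section Lower

variable {q : ℂ[X]} {p : ℂ → ℂ} {U : Set ℂ} {z : ℂ}

/-- The quotient `p / q` in normal form on `U`. -/
def quotientNF (p : ℂ → ℂ) (q : ℂ[X]) (U : Set ℂ) : ℂ → ℂ :=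
  toMeromorphicNFOn (p * (fun z => q.eval z)⁻¹) U

lemma meromorphicOn_quotient (hp : AnalyticOnNhd ℂ p U) :
    MeromorphicOn (p * (fun z => q.eval z)⁻¹) U := fun z hz =>
  (hp z hz).meromorphicAt.mul (analyticAt_eval q z).meromorphicAt.inv

/-- Only an inequality: `p` may vanish at zeros of `q`. -/
lemma poleMultiplicity_quotientNF_le (hp : AnalyticOnNhd ℂ p U) (hq : q ≠ 0) (hz : z ∈ U) :
    poleMultiplicity (quotientNF p q U) z ≤ q.rootMultiplicity z := by
  have h1 : meromorphicOrderAt (quotientNF p q U) z =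
      meromorphicOrderAt p z + -((q.rootMultiplicity z : ℤ) : WithTop ℤ) := by
    rw [quotientNF, meromorphicOrderAt_toMeromorphicNFOn (meromorphicOn_quotient hp) hz,
      meromorphicOrderAt_mul (hp z hz).meromorphicAt (analyticAt_eval q z).meromorphicAt.inv,
      meromorphicOrderAt_inv, meromorphicOrderAt_eval hq]
  have h2 := (hp z hz).meromorphicOrderAt_nonneg
  rw [poleMultiplicity, h1]
  cases h : meromorphicOrderAt p z with
  | top => simp
  | coe k =>
    rw [h] at h2
    have h3 : (0 : ℤ) ≤ k := by exact_mod_cast h2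
    have h4 : ((k : WithTop ℤ) + -((q.rootMultiplicity z : ℤ) : WithTop ℤ)) =
      ((k + -(q.rootMultiplicity z : ℤ) : ℤ) : WithTop ℤ) := rfl
    rw [h4, WithTop.untop₀_coe]
    omega

lemma hasAtMostPoles_quotientNF (hp : AnalyticOnNhd ℂ p U) (hq : q ≠ 0) :
    HasAtMostPoles (quotientNF p q U) U q.natDegree := by
  classical
  have hsub : {z ∈ U | poleMultiplicity (quotientNF p q U) z ≠ 0} ⊆ q.roots.toFinset := by
    rintro z ⟨hz, hz0⟩
    have h1 := poleMultiplicity_quotientNF_le hp hq hz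
    rw [Finset.mem_coe, Multiset.mem_toFinset, ← Multiset.count_pos, count_roots]
    omega
  have hfin : HasFinitelyManyPoles (quotientNF p q U) U := q.roots.toFinset.finite_toSet.subset hsub
  refine ⟨hfin, ?_⟩
  rw [poleCount_eq hfin]
  calc _ ≤ ∑ a ∈ hfin.toFinset, q.rootMultiplicity a := Finset.sum_le_sum fun a ha =>
        poleMultiplicity_quotientNF_le hp hq ((mem_toFinset_poles hfin).1 ha).1
    _ ≤ ∑ a ∈ q.roots.toFinset, q.rootMultiplicity a :=
        Finset.sum_le_sum_of_subset fun a ha => hsub ((mem_toFinset_poles hfin).1 ha)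
    _ = q.roots.card := by
        rw [← Multiset.toFinset_sum_count_eq]
        simp
    _ ≤ _ := q.card_roots'

/-- Equality off the isolated zeros of `q` suffices, since functions in normal form are determined
by their values on a punctured neighbourhood. -/
lemma quotientNF_eventuallyEq (hp : AnalyticOnNhd ℂ p U) (hq : q ≠ 0) (hz : z ∈ U) {f : ℂ → ℂ}
    (hf : AnalyticAt ℂ f z) (h : p =ᶠ[𝓝 z] fun z => q.eval z * f z) :
    quotientNF p q U =ᶠ[𝓝 z] f := by
  have hNF : MeromorphicNFAt (quotientNF p q U) z := meromorphicNFOn_toMeromorphicNFOn _ _ hz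
  rw [← hNF.eventuallyEq_nhdsNE_iff_eventuallyEq_nhds hf.meromorphicNFAt]
  have hq' : ∀ᶠ x in 𝓝[≠] z, q.eval x ≠ 0 := by
    rcases (analyticAt_eval q z).eventually_eq_zero_or_eventually_ne_zero with h0 | h0
    · have := analyticOrderAt_eval hq z
      rw [analyticOrderAt_eq_top.2 h0] at this
      exact absurd this (ENat.top_ne_natCast _)
    · exact h0
  filter_upwards [(meromorphicOn_quotient hp).toMeromorphicNFOn_eq_self_on_nhdsNE hz, hq',
    h.filter_mono nhdsWithin_le_nhds] with x h1 h2 h3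
  rw [quotientNF, h1, Pi.mul_apply, Pi.inv_apply, h3]
  field_simp

variable {S V : Set ℂ} {μ : Measure ℂ} [IsProbabilityMeasure μ] {f F : ℂ → ℂ}
  {α : (n : ℕ) → Fin n → ℂ} {m : ℕ} {Pade : ℕ → RatFunc ℂ} {Q P : ℕ → ℂ[X]} {g : ℕ → ℂ → ℂ}

/-- Fast convergence at one point off the support makes the constants in the telescoping series
small. -/
lemma eventually_norm_const_le (hS : IsCompact S) (hμ : μ Sᶜ = 0) (hα : ∀ n i, α n i ∈ S)
    (hdist : HasZeroDistribution α μ) (hd : PadeData V f α m Pade Q P g) {A : ℕ → ℂ}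
    (hA : ∀ n, m ≤ n → P (n + 1) * Q n - P n * Q (n + 1) = C (A n) * nodePoly α (n + 1))
    {B : ℝ} (hzS : z ∉ S) (hB : ∀ᶠ n in atTop, ‖(Q n).eval z‖ ≤ B)
    (hQz : ∀ᶠ n in atTop, (Q n).eval z ≠ 0) {y : ℂ} {κ η : ℝ} (hκ : 0 < κ) (hη : 0 < η)
    (hzη : ENNReal.ofReal η < expNegPotential μ z)
    (hy : ∀ᶠ n in atTop, ‖y - ratEval (Pade n) z‖ ≤ κ ^ n) :
    ∃ C : ℝ, 0 ≤ C ∧ ∀ᶠ n in atTop, ‖A n‖ ≤ C * (κ / η) ^ n := by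
  have hw := (eventually_le_norm_nodePoly hS hμ hα hdist hzS hη hzη).curry.mono
    fun n hn => hn.self_of_nhds
  refine ⟨(1 + κ) * (B * B) / η, by have := mul_self_nonneg B; positivity, ?_⟩
  have hs := tendsto_add_atTop_nat 1
  filter_upwards [eventually_ge_atTop m, hB, hs.eventually hB, hQz, hs.eventually hQz, hy,
    hs.eventually hy, hs.eventually hw] with n hn b1 b2 z1 z2 y1 y2 hwn
  have hB0 : 0 ≤ B := (norm_nonneg _).trans b1
  have hw0 : 0 < ‖(nodePoly α (n + 1)).eval z‖ := (pow_pos hη _).trans_le hwn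
  have e1 := congrArg (eval z) (hA n hn)
  simp only [eval_sub, eval_mul, eval_C] at e1
  rw [hd.ratEval_eq hn z1] at y1
  rw [hd.ratEval_eq (hn.trans (Nat.le_succ n)) z2] at y2
  have e2 : A n = ((y - (P n).eval z / (Q n).eval z) -
      (y - (P (n + 1)).eval z / (Q (n + 1)).eval z)) * ((Q n).eval z * (Q (n + 1)).eval z) /
      (nodePoly α (n + 1)).eval z := by
    rw [eq_div_iff (norm_pos_iff.1 hw0), ← e1]
    field_simp
    ring
  have e3 : ‖(y - (P n).eval z / (Q n).eval z) -
      (y - (P (n + 1)).eval z / (Q (n + 1)).eval z)‖ ≤ κ ^ n + κ ^ (n + 1) :=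
    (norm_sub_le _ _).trans (add_le_add y1 y2)
  rw [e2, norm_div, norm_mul, norm_mul]
  calc _ ≤ (κ ^ n + κ ^ (n + 1)) * (B * B) / η ^ (n + 1) := by gcongr
    _ = _ := by
      rw [div_pow]
      field_simp
      ring

/-- If the approximants converge faster than expected at one point off the support, the function
has a meromorphic continuation to a larger sublevel set. -/
lemma exists_continuation_of_fast (hS : IsCompact S) (hμ : μ Sᶜ = 0) (hV : IsOpen V)
    (hSV : S ⊆ V) (hf : DifferentiableOn ℂ f V) (hα : ∀ n i, α n i ∈ S)
    (hdist : HasZeroDistribution α μ) (hnewton : IsNewtonian α)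
    (hsingle : IsSingleValued S μ α f m) (hd : PadeData V f α m Pade Q P g) (hq0 : q ≠ 0)
    (hqm : q.natDegree = m)
    (hQ : ∀ j, Tendsto (fun n => (Q n).coeff j) atTop (𝓝 (q.coeff j)))
    (hzS : z ∉ S) (hqz : q.eval z ≠ 0) {y : ℂ} {κ η r : ℝ} (hκ : 0 < κ) (hη : 0 < η)
    (hzη : ENNReal.ofReal η < expNegPotential μ z) (hr : 0 < r) (hrη : r * κ < η)
    (hrZ : rZero S μ < ENNReal.ofReal r)
    (hy : ∀ᶠ n in atTop, ‖y - ratEval (Pade n) z‖ ≤ κ ^ n) :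
    ENNReal.ofReal r ≤ radius S μ f m := by
  have hQm : ∀ᶠ n in atTop, (Q n).natDegree ≤ m :=
    (eventually_ge_atTop m).mono fun n hn => hd.natDegree_denom n hn
  have hA : ∀ n, ∃ A : ℂ, m ≤ n →
      P (n + 1) * Q n - P n * Q (n + 1) = C A * nodePoly α (n + 1) := fun n => by
    by_cases hn : m ≤ n
    · obtain ⟨A, hA⟩ := hd.exists_sub_eq hV hSV hα hnewton hn
      exact ⟨A, fun _ => hA⟩
    · exact ⟨0, fun h => absurd h hn⟩
  choose A hA using hA
  have hQz : Tendsto (fun n => (Q n).eval z) atTop (𝓝 (q.eval z)) :=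
    (tendsto_of_natDegree_le hQm hqm.le hQ {z} Bornology.isBounded_singleton).tendsto_at rfl
  obtain ⟨D, hD0, hD⟩ := eventually_norm_const_le hS hμ hα hdist hd hA hzS
    ((hQz.norm.eventually_lt_const (lt_add_one _)).mono fun n hn => hn.le)
    (hQz.eventually_ne hqz) hκ hη hzη hy
  set U := sublevel μ (ENNReal.ofReal r) with hU
  have hUo : IsOpen U := isOpen_sublevel_ofReal hS hμ r
  -- On `E_μ(r)` the increments `A_n w_{n+1}` are `O((r κ / η)^n)`, and `r κ < η`.
  obtain ⟨p, hp⟩ := tendstoLocallyUniformlyOn_numerators hq0 hQm hqm.le hQ hUo (P := P) (by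
    intro c hc
    refine ⟨D * r, κ / η * r, by positivity, by positivity, ?_, ?_⟩
    · rw [div_mul_eq_mul_div, div_lt_one hη, mul_comm]
      exact hrη
    · have hw := eventually_norm_nodePoly_le hS hμ hα hdist (z₀ := c) (r := r) hc
      have hw' := ((tendsto_add_atTop_nat 1).prodMap tendsto_id).eventually hw
      filter_upwards [hw', ((eventually_ge_atTop m).and hD).prod_inl (𝓝 c)]
        with ⟨n, t⟩ h1 ⟨hn, h2⟩
      dsimp only [Prod.map, id] at h1 h2 hn ⊢
      rw [← eval_mul, ← eval_mul, ← eval_sub, hA n hn, eval_mul, eval_C, norm_mul]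
      calc _ ≤ D * (κ / η) ^ n * r ^ (n + 1) := by gcongr
        _ = _ := by
          rw [mul_pow]
          ring)
  have hpan : AnalyticOnNhd ℂ p U := fun t ht =>
    (hp.differentiableOn (Eventually.of_forall fun n => (P n).differentiable.differentiableOn)
      hUo).analyticAt (hUo.mem_nhds ht)
  have hpoles := hasAtMostPoles_quotientNF hpan hq0
  rw [hqm] at hpoles
  have hcont := hsingle (ENNReal.ofReal r) ENNReal.ofReal_lt_top hrZ (quotientNF p q U)
    (meromorphicNFOn_toMeromorphicNFOn _ _) hpoles fun ζ hζ hlim =>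
    quotientNF_eventuallyEq hpan hq0 hζ
      (hf.analyticAt (hV.mem_nhds (hSV (hlim.mem hS.isClosed hα))))
      (hd.eventuallyEq_of_isLimitNode hV hf hα hSV hS.isClosed hnewton hqm.le hQ hUo hp hζ hlim)
  exact le_sSup ⟨ENNReal.ofReal_lt_top, hrZ, _, hcont, hpoles⟩

/-- If the limsup is below some `κ < u(z) / R`, there are `η < u(z)` with `R κ < η` and `r > R` with
`r κ < η`. Then `f` continues to `E_μ(r)`, contradicting `r > R`. For `R = ∞` the quotient is `0`.
-/
lemma div_le_limsup (hS : IsCompact S) (hμ : μ Sᶜ = 0) (hV : IsOpen V)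
    (hSV : S ⊆ V) (hf : DifferentiableOn ℂ f V) (hα : ∀ n i, α n i ∈ S)
    (hdist : HasZeroDistribution α μ) (hnewton : IsNewtonian α)
    (hsingle : IsSingleValued S μ α f m) (hd : PadeData V f α m Pade Q P g) (hq0 : q ≠ 0)
    (hqm : q.natDegree = m)
    (hQ : ∀ j, Tendsto (fun n => (Q n).coeff j) atTop (𝓝 (q.coeff j)))
    (hzS : z ∉ S) (hqz : q.eval z ≠ 0) (hR : 0 < radius S μ f m) (y : ℂ) :
    expNegPotential μ z / radius S μ f m ≤
      limsup (fun n : ℕ => ‖y - ratEval (Pade n) z‖ₑ ^ (1 / (n : ℝ))) atTop := by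
  by_contra! hlt
  set R := radius S μ f m with hRdef
  have hRt : R ≠ ⊤ := by
    intro h
    rw [h, ENNReal.div_top] at hlt
    exact not_lt_bot hlt
  obtain ⟨κ, hκ, hκ1, hκ2⟩ := exists_ofReal_lt_of_lt hlt
  rw [ENNReal.lt_div_iff_mul_lt (.inl hR.ne') (.inl hRt)] at hκ2
  obtain ⟨η, hη, hη1, hη2⟩ := exists_ofReal_lt_of_lt hκ2
  have h1 : R < ENNReal.ofReal η / ENNReal.ofReal κ := by
    rw [ENNReal.lt_div_iff_mul_lt (.inl (ENNReal.ofReal_pos.2 hκ).ne')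
      (.inl ENNReal.ofReal_ne_top), mul_comm]
    exact hη1
  obtain ⟨r, hr, hr1, hr2⟩ := exists_ofReal_lt_of_lt h1
  rw [← ENNReal.ofReal_div_of_pos hκ, ENNReal.ofReal_lt_ofReal_iff (by positivity),
    lt_div_iff₀ hκ] at hr2
  -- `R > 0` means that the supremum defining `R` is not over the empty set, so `R > r₀`.
  have hrZ : rZero S μ < ENNReal.ofReal r := by
    obtain ⟨t, ht, -⟩ := lt_sSup_iff.1 hR
    exact ht.2.1.trans_le ((le_sSup ht).trans hr1.le)
  refine hr1.not_ge (exists_continuation_of_fast hS hμ hV hSV hf hα hdist hnewton hsingle hd hq0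
    hqm hQ hzS hqz (y := y) hκ hη hη2 hr hr2 hrZ ?_)
  filter_upwards [eventually_lt_of_limsup_lt hκ1, eventually_gt_atTop 0] with n hn hn0
  have hn1 : (0 : ℝ) < n := by exact_mod_cast hn0
  have h2 := ENNReal.rpow_le_rpow hn.le hn1.le
  rw [← ENNReal.rpow_mul, one_div_mul_cancel hn1.ne', ENNReal.rpow_one, ENNReal.rpow_natCast,
    ← ENNReal.ofReal_pow hκ.le, ← ofReal_norm,
    ENNReal.ofReal_le_ofReal_iff (by positivity)] at h2
  exact h2

end Lower

end

end MultipointPade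

/-! ### The main theorem -/

theorem mainTheorem6
    (S : Set ℂ) (hS : IsCompact S) (hSc : IsConnected Sᶜ)
    (μ : Measure ℂ) [IsProbabilityMeasure μ] (hμ : μ Sᶜ = 0)
    (V : Set ℂ) (hV : IsOpen V) (hSV : S ⊆ V)
    (f : ℂ → ℂ) (hf : DifferentiableOn ℂ f V)
    (α : (n : ℕ) → Fin n → ℂ) (hα : ∀ n i, α n i ∈ S)
    (hdist : HasZeroDistribution α μ) (hnewton : IsNewtonian α)
    (m : ℕ) (hsingle : IsSingleValued S μ α f m)
    (Pade : ℕ → RatFunc ℂ) (hPade : ∀ n, m ≤ n → IsMultipointPade V f α n m (Pade n))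
    (F : ℂ → ℂ) (hF : IsMeromorphicContinuation S μ f (radius S μ f m) F)
    (hpoles : HasExactlyPoles F (meromorphySet S μ f m) m) :
    ∀ z ∈ meromorphySet S μ f m, z ∉ S → poleMultiplicity F z = 0 →
      limsup (fun n : ℕ => ‖F z - ratEval (Pade n) z‖ₑ ^ (1 / (n : ℝ))) atTop =
          rho μ {z} / radius S μ f m ∧
        rho μ {z} / radius S μ f m < 1 := by
  intro z hz hzS hz0
  have hrho : rho μ {z} = expNegPotential μ z := by simp [rho]
  rw [hrho]
  have hzR : expNegPotential μ z < radius S μ f m := hz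
  have hR : 0 < radius S μ f m := bot_le.trans_lt hzR
  obtain ⟨hfin, hcount⟩ := hpoles
  have hqm : (polePoly hfin).natDegree = m := (natDegree_polePoly hfin).trans hcount
  obtain ⟨Q, P, g, hd, hQ⟩ := exists_normalized_padeData hS hμ hV hSV hf hα hdist hF hR hfin hqm
    hPade
  refine ⟨le_antisymm
    (limsup_le_div hS hμ hV hSV hf hα hdist hF hfin hqm hd hQ hz hz0)
    (div_le_limsup hS hμ hV hSV hf hα hdist hnewton hsingle hd (monic_polePoly hfin).ne_zero hqm hQ
      hzS (fun h => ((isRoot_polePoly_iff hfin).1 h).2 hz0) hR (F z)), ?_⟩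
  rw [ENNReal.div_lt_iff (.inl hR.ne') (.inr (expNegPotential_lt_top hS hμ z).ne), one_mul]
  exact hzR
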